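/- All graphs are finite, simple and undirected (not necessarily connected). For an integer $k \ge 1$, a $k$-labelling of a graph $G$ is a map $\ell : E(G) \to \{1,\dots,k\}$; for a vertex $v$ put $\rho_\ell(v) = \prod_{u \in N(v)} \ell(uv)$ (the empty product being $1$). The labelling $\ell$ is p-proper if $\rho_\ell(u) \ne \rho_\ell(v)$ for every edge $uv$ of $G$, and $\chi_{\rm P}(G)$ denotes the smallest $k \ge 1$ such that $G$ admits a p-proper $k$-labelling ($\infty$ if there is none). A graph is nice if none of its connected components is isomorphic to $K_2$. **Statement.** Every nice regular graph $G$ satisfies $\chi_{\rm P}(G) \le 3$. -/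

import Mathlib

namespace SimpleGraph

/-- A `k`-labelling of `G`: a map from the edges of `G` to `{1, …, k}`. -/
abbrev NatLabelling {V : Type*} (G : SimpleGraph V) (k : ℕ) : Type _ :=
  G.EdgeLabeling (Set.Icc 1 k)

/-- The product `ρ_ℓ(v)` of the labels assigned to the edges incident to `v`. -/
def labelProd {V : Type*} (G : SimpleGraph V) [G.LocallyFinite] {k : ℕ}
    (l : G.NatLabelling k) (v : V) : ℕ :=
  ∏ u : G.neighborSet v, (l.get v u.1 u.2 : ℕ)

/-- `l` is p-proper: the vertex products form a proper vertex-colouring of `G`. -/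
def IsPProper {V : Type*} (G : SimpleGraph V) [G.LocallyFinite] {k : ℕ}
    (l : G.NatLabelling k) : Prop :=
  ∀ u v : V, G.Adj u v → G.labelProd l u ≠ G.labelProd l v

/-- `χ_P(G)`: the smallest `k ≥ 1` such that `G` admits a p-proper `k`-labelling;
it is `⊤` if there is no such `k`. -/
noncomputable def chiP {V : Type*} (G : SimpleGraph V) [G.LocallyFinite] : ℕ∞ :=
  ⨅ k ∈ {k : ℕ | 1 ≤ k ∧ ∃ l : G.NatLabelling k, G.IsPProper l}, (k : ℕ∞)

/-- A graph is nice if none of its connected components is isomorphic to `K₂`. -/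
def IsNice {V : Type*} (G : SimpleGraph V) : Prop :=
  ∀ C : G.ConnectedComponent, IsEmpty (C.toSimpleGraph ≃g completeGraph (Fin 2))

end SimpleGraph

/-! The product at a vertex is `2 ^ p * 3 ^ q`, where `p` and `q` count its incident edges labelled
2 and 3, so adjacent vertices must differ in `(p, q)`. Take a proper colouring with least colour
sum; a vertex of colour `k` then has a neighbour of every smaller colour.

High vertices (colour at least 3) are treated from the largest colour down, each labelling some of
its edges to smaller colours (`IsPartialLabelling.exists_step`). Such an edge gets 2 or 3 according
as its lower end has odd or even colour. Edges from above therefore bring a vertex of colour `k`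
only one of the two labels; the count of the other is its own choice and is made `k / 2`. The count
of the first is made positive, with the parity for which `p + q` and `k` have opposite parities.
High neighbours then differ in the parity of `p + q` if their colours have different parities, and
in the exact count otherwise.

Low vertices induce a bipartite graph in which colour 1 has received only labels 2 and colour 2 only
labels 3. `separable_univ` labels edges inside it so that neighbours differ and every low vertex has
`p = 0`, or `q = 0`, or `p = 1` with `q` even; high vertices avoid all three types. The only
obstruction is a component that is a single edge with no label at its ends. In a nice graph such an
edge has a high neighbour, and exchanging its two colours, which keeps the colour sum, allows that
neighbour to label an edge to one of its ends. -/

namespace SimpleGraph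

open Finset

/-! ### Degrees in edge sets, for matchings towards a set and for stars. -/

section IncidenceCount

variable {V : Type*} [DecidableEq V]

/-- The number of edges of `E` incident with the vertex `v`. -/
def incCount (E : Finset (Sym2 V)) (v : V) : ℕ := #{e ∈ E | v ∈ e}

lemma incCount_eq_zero {E : Finset (Sym2 V)} {v : V} :
    incCount E v = 0 ↔ ∀ e ∈ E, v ∉ e := by
  simp [incCount, Finset.filter_eq_empty_iff]

lemma incCount_pos {E : Finset (Sym2 V)} {v : V} :
    0 < incCount E v ↔ ∃ e ∈ E, v ∈ e := by
  simp [incCount, Finset.card_pos, Finset.filter_nonempty_iff]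

@[simp] lemma incCount_empty (v : V) : incCount (∅ : Finset (Sym2 V)) v = 0 := rfl

lemma incCount_union {E F : Finset (Sym2 V)} (h : Disjoint E F) (v : V) :
    incCount (E ∪ F) v = incCount E v + incCount F v := by
  unfold incCount
  rw [Finset.filter_union, Finset.card_union_of_disjoint]
  exact Finset.disjoint_filter_filter h

lemma incCount_mono {E F : Finset (Sym2 V)} (h : E ⊆ F) (v : V) :
    incCount E v ≤ incCount F v :=
  Finset.card_le_card (Finset.filter_subset_filter _ h)

lemma incCount_insert {E : Finset (Sym2 V)} {e : Sym2 V} (h : e ∉ E) (v : V) :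
    incCount (insert e E) v = (if v ∈ e then 1 else 0) + incCount E v := by
  unfold incCount
  rw [Finset.filter_insert]
  split_ifs
  · rw [Finset.card_insert_of_notMem (by simp [h]), add_comm]
  · simp

lemma incCount_singleton (e : Sym2 V) (v : V) :
    incCount {e} v = if v ∈ e then 1 else 0 := by
  unfold incCount
  rw [Finset.filter_singleton]
  split_ifs <;> rfl

lemma incCount_symmDiff (E F : Finset (Sym2 V)) (v : V) :
    (incCount (symmDiff E F) v : ZMod 2) = incCount E v + incCount F v := by
  have h1 : incCount (symmDiff E F) v = incCount (E \ F) v + incCount (F \ E) v :=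
    incCount_union disjoint_sdiff_sdiff v
  have h2 : incCount E v = incCount (E \ F) v + incCount (E ∩ F) v := by
    rw [← incCount_union (Finset.disjoint_sdiff_inter E F), Finset.sdiff_union_inter]
  have h3 : incCount F v = incCount (F \ E) v + incCount (E ∩ F) v := by
    rw [Finset.inter_comm, ← incCount_union (Finset.disjoint_sdiff_inter F E),
      Finset.sdiff_union_inter]
  rw [h1, h2, h3]
  push_cast
  linear_combination -(CharTwo.add_self_eq_zero (incCount (E ∩ F) v : ZMod 2))

/-- The edges joining each vertex of `Q` to its image under `f`. -/
def joinEdges (Q : Finset V) (f : V → V) : Finset (Sym2 V) := Q.image fun v => s(v, f v)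

lemma mem_joinEdges {Q : Finset V} {f : V → V} {e : Sym2 V} :
    e ∈ joinEdges Q f ↔ ∃ v ∈ Q, s(v, f v) = e := by
  simp [joinEdges]

lemma incCount_joinEdges_of_mem {Q : Finset V} {f : V → V} (hf : ∀ v ∈ Q, f v ∉ Q) {b : V}
    (hb : b ∈ Q) : incCount (joinEdges Q f) b = 1 := by
  unfold incCount
  rw [Finset.card_eq_one]
  refine ⟨s(b, f b), ?_⟩
  ext e
  simp only [Finset.mem_filter, mem_joinEdges, Finset.mem_singleton]
  constructor
  · rintro ⟨⟨v, hv, rfl⟩, h⟩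
    rcases Sym2.mem_iff.1 h with rfl | rfl
    · rfl
    · exact absurd hb (hf v hv)
  · rintro rfl
    exact ⟨⟨b, hb, rfl⟩, by simp⟩

lemma incCount_joinEdges_eq_zero {Q : Finset V} {f : V → V} {b : V} (hb : b ∉ Q)
    (hf : ∀ v ∈ Q, f v ≠ b) : incCount (joinEdges Q f) b = 0 := by
  rw [incCount_eq_zero]
  intro e he hbe
  obtain ⟨v, hv, rfl⟩ := mem_joinEdges.1 he
  rcases Sym2.mem_iff.1 hbe with rfl | rfl
  · exact hb hv
  · exact hf v hv rfl

lemma incCount_joinEdges_eq_one {Q : Finset V} {f : V → V} {b v : V} (hb : b ∉ Q)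
    (hv : v ∈ Q) (hvb : f v = b) (huniq : ∀ v' ∈ Q, f v' = b → v' = v) :
    incCount (joinEdges Q f) b = 1 := by
  unfold incCount
  rw [Finset.card_eq_one]
  refine ⟨s(v, f v), ?_⟩
  ext e
  simp only [Finset.mem_filter, mem_joinEdges, Finset.mem_singleton]
  constructor
  · rintro ⟨⟨v', hv', rfl⟩, h⟩
    rcases Sym2.mem_iff.1 h with rfl | h
    · exact absurd hv' hb
    · rw [huniq v' hv' h.symm]
  · rintro rfl
    exact ⟨⟨v, hv, rfl⟩, by simp [hvb]⟩

/-- The star joining `w` to the vertices of `X`. -/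
def starEdges (w : V) (X : Finset V) : Finset (Sym2 V) := X.image fun z => s(w, z)

lemma mem_starEdges {w : V} {X : Finset V} {e : Sym2 V} :
    e ∈ starEdges w X ↔ ∃ z ∈ X, s(w, z) = e := by
  simp [starEdges]

lemma incCount_starEdges_center (w : V) (X : Finset V) : incCount (starEdges w X) w = #X := by
  unfold incCount
  rw [Finset.filter_true_of_mem, starEdges, Finset.card_image_of_injective]
  · exact fun a b h => Sym2.congr_right.1 h
  · intro e he
    obtain ⟨z, -, rfl⟩ := mem_starEdges.1 he
    simp

end IncidenceCount

/-! ### Edge sets with prescribed degree parities (T-joins). -/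

section TJoin

variable {V : Type*} [DecidableEq V]

lemma Reachable.exists_incCount_parity {G : SimpleGraph V} {a b : V} (h : G.Reachable a b) :
    ∃ F : Finset (Sym2 V), (∀ e ∈ F, e ∈ G.edgeSet) ∧
      ∀ v, (incCount F v : ZMod 2) = (if v = a then 1 else 0) + (if v = b then 1 else 0) := by
  obtain ⟨p⟩ := h
  induction p with
  | nil => exact ⟨∅, by simp, fun v => by split_ifs <;> simp; decide⟩
  | @cons a a' b hadj p ih =>
    obtain ⟨F, hF, hc⟩ := ih
    refine ⟨symmDiff F {s(a, a')}, fun e he => ?_, fun v => ?_⟩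
    · rcases Finset.mem_symmDiff.1 he with h | h
      · exact hF e h.1
      · rw [Finset.mem_singleton.1 h.1]
        exact hadj
    · rw [incCount_symmDiff, hc, incCount_singleton]
      have hne := hadj.ne
      by_cases h1 : v = a
      · subst h1
        simp [hne, add_comm]
      · by_cases h2 : v = a'
        · subst h2
          simp only [h1, if_true, if_false, Sym2.mem_iff, or_true, Nat.cast_one]
          linear_combination CharTwo.add_self_eq_zero (1 : ZMod 2)
        · simp [h1, h2]

/-- Edge sets with prescribed degree parities away from one root in every component. -/
theorem exists_incCount_parity [Fintype V] (G : SimpleGraph V) (root : G.ConnectedComponent → V)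
    (hroot : ∀ K, G.connectedComponentMk (root K) = K) (τ : V → ZMod 2) :
    ∃ F : Finset (Sym2 V), (∀ e ∈ F, e ∈ G.edgeSet) ∧
      ∀ v, v ≠ root (G.connectedComponentMk v) → (incCount F v : ZMod 2) = τ v := by
  suffices H : ∀ S : Finset V, ∃ F : Finset (Sym2 V), (∀ e ∈ F, e ∈ G.edgeSet) ∧
      ∀ v, v ≠ root (G.connectedComponentMk v) →
        (incCount F v : ZMod 2) = if v ∈ S then 1 else 0 by
    obtain ⟨F, hF, hc⟩ := H {v | τ v = 1}
    refine ⟨F, hF, fun v hv => ?_⟩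
    rw [hc v hv]
    have : ∀ t : ZMod 2, (if t = 1 then (1 : ZMod 2) else 0) = t := by decide
    simpa using this (τ v)
  intro S
  induction S using Finset.induction_on with
  | empty => exact ⟨∅, by simp, by simp⟩
  | insert a S ha ih =>
    obtain ⟨F, hF, hc⟩ := ih
    have hr : G.Reachable a (root (G.connectedComponentMk a)) :=
      (ConnectedComponent.exact (hroot _)).symm
    obtain ⟨P, hP, hPc⟩ := hr.exists_incCount_parity
    -- Adding modulo 2 a path from `a` to its root changes the parity only at `a` and at the root,
    -- where nothing is prescribed.
    refine ⟨symmDiff F P, fun e he => ?_, fun v hv => ?_⟩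
    · rcases Finset.mem_symmDiff.1 he with h | h
      · exact hF e h.1
      · exact hP e h.1
    · rw [incCount_symmDiff, hc v hv, hPc]
      have hv' : v ≠ root (G.connectedComponentMk a) := by
        intro h
        apply hv
        have := hroot (G.connectedComponentMk a)
        rw [← h] at this
        rw [this]
        exact h
      by_cases h1 : v = a
      · subst h1
        simp [ha, hv']
      · simp [h1, hv']

/-- In a graph whose edges all join `R` to its complement, there is an edge set covering every
non-isolated vertex outside `R` whose parities on `R`, shifted by `X`, are constant on
components. -/
theorem exists_incCount_parity_cover [Fintype V] (G : SimpleGraph V) (R : Set V)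
    (hR : ∀ a b, G.Adj a b → (a ∈ R ↔ b ∉ R)) (X : V → ZMod 2) :
    ∃ (E : Finset (Sym2 V)) (t : G.ConnectedComponent → ZMod 2), (∀ e ∈ E, e ∈ G.edgeSet) ∧
      (∀ u ∈ R, (incCount E u : ZMod 2) + X u = t (G.connectedComponentMk u)) ∧
      ∀ v ∉ R, (∃ u, G.Adj v u) → 1 ≤ incCount E v := by
  classical
  have hex : ∀ K : G.ConnectedComponent, ∃ r, G.connectedComponentMk r = K ∧
      ((∃ u ∈ R, G.connectedComponentMk u = K) → r ∈ R) := by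
    intro K
    by_cases h : ∃ u ∈ R, G.connectedComponentMk u = K
    · obtain ⟨u, hu, hK⟩ := h
      exact ⟨u, hK, fun _ => hu⟩
    · obtain ⟨r, hr⟩ := K.exists_rep
      exact ⟨r, hr, fun h' => absurd h' h⟩
  choose root hroot hrootR using hex
  let full : Finset (Sym2 V) := {e | e ∈ G.edgeSet}
  -- The target of a component is the value its root attains when all edges are used. A root off
  -- target thus has an edge missing from `F`; adding that edge corrects the root and can only raise
  -- counts outside `R`, which are odd and hence positive already.
  let t : G.ConnectedComponent → ZMod 2 := fun K => X (root K) + incCount full (root K)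
  obtain ⟨F, hF, hc⟩ := exists_incCount_parity G root hroot
    (fun v => if v ∈ R then t (G.connectedComponentMk v) + X v else 1)
  let bad : Finset V := {u | u ∈ R ∧ (incCount F u : ZMod 2) + X u ≠ t (G.connectedComponentMk u)}
  have hbadroot : ∀ u ∈ bad, u = root (G.connectedComponentMk u) := by
    intro u hu
    by_contra hne
    obtain ⟨huR, hu2⟩ := (Finset.mem_filter.1 hu).2
    apply hu2
    rw [hc u hne, if_pos huR, add_assoc, CharTwo.add_self_eq_zero, add_zero]
  have hmiss : ∀ u, ∃ v, u ∈ bad → G.Adj u v ∧ s(u, v) ∉ F := by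
    intro u
    by_cases hu : u ∈ bad
    · by_contra! hcon
      have hcon' : ∀ v, G.Adj u v → s(u, v) ∈ F := fun v h => (hcon v).2 h
      apply (Finset.mem_filter.1 hu).2.2
      have hfull : incCount F u = incCount full u := by
        unfold incCount
        congr 1
        ext e
        simp only [Finset.mem_filter, full, Finset.mem_univ, true_and, and_congr_left_iff]
        intro hue
        refine ⟨hF e, fun he => ?_⟩
        obtain ⟨v, rfl⟩ := hue
        exact hcon' v he
      change _ = X (root _) + (incCount full (root _) : ZMod 2)
      rw [← hbadroot u hu, hfull, add_comm]
    · exact ⟨u, fun h => absurd h hu⟩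
  choose m hm using hmiss
  have hmR : ∀ u ∈ bad, m u ∉ R := fun u hu =>
    (hR _ _ (hm u hu).1).1 (Finset.mem_filter.1 hu).2.1
  have hdisj : Disjoint F (joinEdges bad m) := by
    rw [Finset.disjoint_left]
    intro e he he'
    obtain ⟨u, hu, rfl⟩ := mem_joinEdges.1 he'
    exact (hm u hu).2 he
  refine ⟨F ∪ joinEdges bad m, t, fun e he => ?_, fun u hu => ?_, fun v hv hadj => ?_⟩
  · rcases Finset.mem_union.1 he with h | h
    · exact hF e h
    · obtain ⟨u, hu, rfl⟩ := mem_joinEdges.1 h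
      exact (hm u hu).1
  · rw [incCount_union hdisj]
    by_cases hb : u ∈ bad
    · rw [incCount_joinEdges_of_mem _ hb]
      · have h2 := (Finset.mem_filter.1 hb).2.2
        have : ∀ a b c : ZMod 2, a + b ≠ c → a + 1 + b = c := by decide
        push_cast
        exact this _ _ _ h2
      · intro v hv hmv
        exact hmR v hv (Finset.mem_filter.1 hmv).2.1
    · rw [incCount_joinEdges_eq_zero hb]
      · by_contra hne
        exact hb (by simpa [bad, hu] using hne)
      · rintro v hv rfl
        exact hmR v hv hu
  · obtain ⟨u, hu⟩ := hadj
    have huR : u ∈ R := by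
      have := hR v u hu
      tauto
    have hK : G.connectedComponentMk u = G.connectedComponentMk v :=
      ConnectedComponent.sound hu.symm.reachable
    have hne : v ≠ root (G.connectedComponentMk v) := by
      intro h
      apply hv
      rw [h]
      exact hrootR _ ⟨u, huR, hK⟩
    have h1 := hc v hne
    rw [if_neg hv] at h1
    have : incCount F v ≠ 0 := by
      intro h0
      rw [h0] at h1
      exact absurd h1 (by decide)
    have := incCount_mono (Finset.subset_union_left (s₁ := F) (s₂ := joinEdges bad m)) v
    omega

end TJoin

/-! ### Separating a connected bipartite graph after deleting a set `R`. -/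

section Bipartite

/-- Take the vertex just before a walk first enters `R`. It is outside `A` because its successor
lies in `R ⊆ A`. -/
lemma Reachable.exists_port {V : Type*} {H : SimpleGraph V} {S A R : Set V}
    (hS : ∀ a ∈ S, ∀ b, H.Adj a b → b ∈ S)
    (hA : ∀ a b, H.Adj a b → (a ∈ A ↔ b ∉ A)) (hRA : R ⊆ A) {a r : V} (h : H.Reachable a r)
    (ha : a ∈ S) (haR : a ∉ R) (hr : r ∈ R) {Γ : SimpleGraph V}
    (hΓ : ∀ a b, Γ.Adj a b ↔ H.Adj a b ∧ a ∈ S ∧ a ∉ R ∧ b ∉ R) :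
    ∃ p, Γ.Reachable a p ∧ p ∈ S ∧ p ∉ A ∧ ∃ u ∈ R, H.Adj p u := by
  obtain ⟨p⟩ := h
  induction p with
  | nil => exact absurd hr haR
  | @cons a b r hadj p ih =>
    by_cases hb : b ∈ R
    · refine ⟨a, Reachable.refl _, ha, fun haA => ?_, b, hb, hadj⟩
      exact (hA a b hadj).1 haA (hRA hb)
    · obtain ⟨q, hq, h⟩ := ih (hS a ha b hadj) hb hr
      exact ⟨q, ((hΓ a b).2 ⟨hadj, ha, haR, hb⟩).reachable.trans hq, h⟩

variable {V : Type*} [DecidableEq V]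

/-- Starting from `x v` factors `2` and `y v` factors `3`, the vertices of `S` can be separated by
labelling `2` and `3` some edges of `H` inside `S`, so that each vertex of `S` has only
factors of one kind, or exactly one factor `2` and an even number of factors `3`. -/
def Separable (H : SimpleGraph V) (S : Set V) (x y : V → ℕ) : Prop :=
  ∃ E₂ E₃ : Finset (Sym2 V), Disjoint E₂ E₃ ∧
    (∀ e ∈ E₂ ∪ E₃, e ∈ H.edgeSet ∧ ∀ v ∈ e, v ∈ S) ∧
    (∀ v ∈ S, x v + incCount E₂ v = 0 ∨ y v + incCount E₃ v = 0 ∨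
      (x v + incCount E₂ v = 1 ∧ Even (y v + incCount E₃ v))) ∧
    ∀ a ∈ S, ∀ b ∈ S, H.Adj a b →
      x a + incCount E₂ a ≠ x b + incCount E₂ b ∨ y a + incCount E₃ a ≠ y b + incCount E₃ b

/-- Delete `R` and choose label-3 edges `F` making the total count `q` even on `A` and odd off `A`,
except possibly at one root per remaining component. Each root is off `A` and has a neighbour in
`R`, while `q = 0` on `R`. Only the roots with even `q`, collected in `Q`, need labels 2: from `Eb`
if `q > 0`, from `Ed` and `Ez` if `q = 0`. -/
theorem separable_of_removal [Fintype V] (H : SimpleGraph V) (S A R : Set V) (x y : V → ℕ)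
    (hS : ∀ a ∈ S, ∀ b, H.Adj a b → b ∈ S)
    (hA : ∀ a b, H.Adj a b → (a ∈ A ↔ b ∉ A))
    (hconn : ∀ a ∈ S, ∀ b ∈ S, H.Reachable a b)
    (hx : ∀ v ∉ A, x v = 0) (hy : ∀ v ∈ A, y v = 0)
    (hRA : R ⊆ A) (hRS : R ⊆ S) (hRne : R.Nonempty)
    (hxR : ∀ v ∈ S, v ∈ A → v ∉ R → x v = 0)
    (hleaf : ∀ v ∈ S, v ∉ A → y v = 0 → (∀ z, H.Adj v z → z ∈ R) → ∀ z, H.Adj v z → 1 ≤ x z) :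
    H.Separable S x y := by
  classical
  obtain ⟨r₀, hr₀⟩ := hRne
  let Γ : SimpleGraph V :=
    { Adj := fun a b => H.Adj a b ∧ (a ∈ S ∧ b ∈ S) ∧ a ∉ R ∧ b ∉ R
      symm := ⟨fun a b h => ⟨h.1.symm, h.2.1.symm, h.2.2.2, h.2.2.1⟩⟩
      loopless := ⟨fun a h => h.1.ne rfl⟩ }
  have hΓ : ∀ a b, Γ.Adj a b ↔ H.Adj a b ∧ a ∈ S ∧ a ∉ R ∧ b ∉ R := fun a b =>
    ⟨fun h => ⟨h.1, h.2.1.1, h.2.2⟩, fun h => ⟨h.1, ⟨h.2.1, hS a h.2.1 b h.1⟩, h.2.2⟩⟩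
  -- the roots
  have hex : ∀ K : Γ.ConnectedComponent, ∃ r, Γ.connectedComponentMk r = K ∧
      ((∃ a, Γ.connectedComponentMk a = K ∧ a ∈ S ∧ a ∉ R) →
        r ∈ S ∧ r ∉ A ∧ ∃ u ∈ R, H.Adj r u) := by
    intro K
    by_cases h : ∃ a, Γ.connectedComponentMk a = K ∧ a ∈ S ∧ a ∉ R
    · obtain ⟨a, rfl, haS, haR⟩ := h
      obtain ⟨p, hp, h⟩ := (hconn a haS r₀ (hRS hr₀)).exists_port hS hA hRA haS haR hr₀ hΓ
      exact ⟨p, ConnectedComponent.sound hp.symm, fun _ => h⟩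
    · obtain ⟨r, hr⟩ := K.exists_rep
      exact ⟨r, hr, fun h' => absurd h' h⟩
  choose root hroot hport using hex
  have hmk : ∀ {a b}, Γ.Adj a b → Γ.connectedComponentMk a = Γ.connectedComponentMk b :=
    fun h => ConnectedComponent.sound h.reachable
  obtain ⟨F, hF, hc⟩ := exists_incCount_parity Γ root hroot
    (fun v => if v ∈ A then 0 else 1 + y v)
  set q : V → ℕ := fun v => y v + incCount F v with hq
  have hFR : ∀ v, (v ∈ R ∨ v ∉ S) → incCount F v = 0 := by
    intro v hv
    rw [incCount_eq_zero]
    rintro e he ⟨w, rfl⟩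
    have : Γ.Adj v w := hF _ he
    rcases hv with hv | hv
    · exact this.2.2.1 hv
    · exact hv this.2.1.1
  have hqR : ∀ v ∈ R, q v = 0 := fun v hv => by simp [hq, hFR v (Or.inl hv), hy v (hRA hv)]
  have hrootA : ∀ v ∈ S, v ∈ A → v ∉ R → v ≠ root (Γ.connectedComponentMk v) := by
    intro v hvS hvA hvR h
    have := (hport (Γ.connectedComponentMk v) ⟨v, rfl, hvS, hvR⟩).2.1
    rw [← h] at this
    exact this hvA
  have hqA : ∀ v ∈ S, v ∈ A → Even (q v) := by
    intro v hvS hvA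
    by_cases hvR : v ∈ R
    · simp [hqR v hvR]
    · have := hc v (hrootA v hvS hvA hvR)
      rw [if_pos hvA, ZMod.natCast_eq_zero_iff_even] at this
      simpa [hq, hy v hvA] using this
  let Q : Finset V := {v | v ∈ S ∧ v ∉ A ∧ Even (q v)}
  have hQ : ∀ {v}, v ∈ Q ↔ v ∈ S ∧ v ∉ A ∧ Even (q v) := by simp [Q]
  have hQR : ∀ v ∈ Q, v ∉ R := fun v hv h => (hQ.1 hv).2.1 (hRA h)
  have hQroot : ∀ v ∈ Q, v = root (Γ.connectedComponentMk v) := by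
    intro v hv
    by_contra hne
    have h1 := hc v hne
    obtain ⟨_, hvA, hev⟩ := hQ.1 hv
    rw [if_neg hvA] at h1
    rw [← ZMod.natCast_eq_zero_iff_even] at hev
    simp only [hq] at hev
    push_cast at hev
    rw [h1] at hev
    have : ∀ a : ZMod 2, a + (1 + a) ≠ 0 := by decide
    exact this _ hev
  have hQuniq : ∀ v ∈ Q, ∀ v' ∈ Q, ∀ z, Γ.Adj v z → Γ.Adj v' z → v' = v := by
    intro v hv v' hv' z h h'
    rw [hQroot v hv, hQroot v' hv', hmk h, hmk h']
  have hQport : ∀ v, ∃ u, v ∈ Q → u ∈ R ∧ H.Adj v u := by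
    intro v
    by_cases hv : v ∈ Q
    · obtain ⟨-, -, u, hu, hadj⟩ :=
        hport (Γ.connectedComponentMk v) ⟨v, rfl, (hQ.1 hv).1, hQR v hv⟩
      rw [← hQroot v hv] at hadj
      exact ⟨u, fun _ => ⟨hu, hadj⟩⟩
    · exact ⟨v, fun h => absurd h hv⟩
  choose m hm using hQport
  -- A root in `Q₂` gets `p = 1` from one edge to `R`: its neighbours outside `R` keep `p = 0`,
  -- those in `R` have `q = 0`. Roots in `Q₀` are told apart from `R` by the parity of `p`. The rest
  -- of `Q` has `q = 0` and all neighbours in `R`, which is the case for `hleaf`.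
  let Q₂ : Finset V := {v ∈ Q | q v ≠ 0}
  let Q₀ : Finset V := {v ∈ Q | q v = 0 ∧ ∃ z, H.Adj v z ∧ z ∉ R}
  have hQ₂ : ∀ {v}, v ∈ Q₂ ↔ v ∈ Q ∧ q v ≠ 0 := by simp [Q₂]
  have hQ₀ : ∀ {v}, v ∈ Q₀ ↔ v ∈ Q ∧ q v = 0 ∧ ∃ z, H.Adj v z ∧ z ∉ R := by simp [Q₀]
  have hQ₀z : ∀ v, ∃ z, v ∈ Q₀ → H.Adj v z ∧ z ∉ R := by
    intro v
    by_cases hv : v ∈ Q₀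
    · obtain ⟨z, hz⟩ := (hQ₀.1 hv).2.2
      exact ⟨z, fun _ => hz⟩
    · exact ⟨v, fun h => absurd h hv⟩
  choose zf hzf using hQ₀z
  let Eb := joinEdges Q₂ m
  let Λ : SimpleGraph V :=
    { Adj := fun a b => H.Adj a b ∧ ((a ∈ R ∧ b ∈ Q₀) ∨ (b ∈ R ∧ a ∈ Q₀))
      symm := ⟨fun a b h => ⟨h.1.symm, h.2.symm⟩⟩
      loopless := ⟨fun a h => h.1.ne rfl⟩ }
  have hQ₀R : ∀ v ∈ Q₀, v ∉ R := fun v hv => hQR v (hQ₀.1 hv).1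
  -- The shift counts the factors 2 already present on `R`, so `t` is the final parity of `p` on the
  -- `R`-part of each component of `Λ`.
  obtain ⟨Ed, t, hEd, hEdR, hEd1⟩ := exists_incCount_parity_cover Λ R (by
    rintro a b ⟨_, ⟨h1, h2⟩ | ⟨h1, h2⟩⟩
    · simp [h1, hQ₀R b h2]
    · simp [h1, hQ₀R a h2]) (fun u => ((x u + incCount Eb u : ℕ) : ZMod 2))
  -- A vertex of `Q₀` whose parity agrees with its neighbours in `R` gets one more label 2, on an
  -- edge to some `z` outside `R`. Then `p = 1` at `z` but `p ≥ 2` at the vertex itself, so the two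
  -- still differ.
  let Qz : Finset V := {v ∈ Q₀ | (incCount Ed v : ZMod 2) = t (Λ.connectedComponentMk v)}
  have hQz : ∀ {v}, v ∈ Qz ↔ v ∈ Q₀ ∧ (incCount Ed v : ZMod 2) = t (Λ.connectedComponentMk v) := by
    simp [Qz]
  let Ez := joinEdges Qz zf
  have hzΓ : ∀ v ∈ Q₀, Γ.Adj v (zf v) := fun v hv =>
    (hΓ _ _).2 ⟨(hzf v hv).1, (hQ.1 (hQ₀.1 hv).1).1, hQ₀R v hv, (hzf v hv).2⟩
  have hzA : ∀ v ∈ Q₀, zf v ∈ A := fun v hv => by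
    have := hA _ _ (hzf v hv).1
    have := (hQ.1 (hQ₀.1 hv).1).2.1
    tauto
  -- disjointness
  have hEdform : ∀ e ∈ Ed, ∃ u ∈ R, ∃ v ∈ Q₀, H.Adj u v ∧ e = s(u, v) := by
    intro e he
    have := hEd e he
    induction e with
    | _ a b =>
      obtain ⟨h, ⟨h1, h2⟩ | ⟨h1, h2⟩⟩ := this
      · exact ⟨a, h1, b, h2, h, rfl⟩
      · exact ⟨b, h1, a, h2, h.symm, Sym2.eq_swap⟩
  have hbd : Disjoint Eb Ed := by
    rw [Finset.disjoint_left]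
    intro e he he'
    obtain ⟨v, hv, rfl⟩ := mem_joinEdges.1 he
    obtain ⟨u, hu, w, hw, -, h⟩ := hEdform _ he'
    rcases Sym2.eq_iff.1 h with ⟨rfl, -⟩ | ⟨rfl, -⟩
    · exact hQR _ (hQ₂.1 hv).1 hu
    · exact (hQ₂.1 hv).2 (hQ₀.1 hw).2.1
  have hbdz : Disjoint (Eb ∪ Ed) Ez := by
    rw [Finset.disjoint_left]
    intro e he he'
    obtain ⟨v, hv, rfl⟩ := mem_joinEdges.1 he'
    have hv0 := (hQz.1 hv).1
    rcases Finset.mem_union.1 he with he | he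
    · obtain ⟨w, hw, h⟩ := mem_joinEdges.1 he
      have hmR := (hm w (hQ₂.1 hw).1).1
      rcases Sym2.eq_iff.1 h with ⟨-, h⟩ | ⟨-, h⟩
      · exact (hzf v hv0).2 (h ▸ hmR)
      · exact hQ₀R v hv0 (h ▸ hmR)
    · obtain ⟨u, hu, w, hw, -, h⟩ := hEdform _ he
      rcases Sym2.eq_iff.1 h with ⟨h, -⟩ | ⟨-, h⟩
      · exact hQ₀R v hv0 (h ▸ hu)
      · exact (hzf v hv0).2 (h ▸ hu)
  have hcount : ∀ v, incCount (Eb ∪ Ed ∪ Ez) v = incCount Eb v + incCount Ed v + incCount Ez v :=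
    fun v => by rw [incCount_union hbdz, incCount_union hbd]
  -- counts
  have hEb0 : ∀ v ∉ R, v ∉ Q₂ → incCount Eb v = 0 := fun v hv hv2 =>
    incCount_joinEdges_eq_zero hv2 (fun w hw h => hv (h ▸ (hm w (hQ₂.1 hw).1).1))
  have hEb1 : ∀ v ∈ Q₂, incCount Eb v = 1 := fun v hv =>
    incCount_joinEdges_of_mem (fun w hw h =>
      hQR _ (hQ₂.1 h).1 (hm w (hQ₂.1 hw).1).1) hv
  have hEd0 : ∀ v ∉ R, v ∉ Q₀ → incCount Ed v = 0 := by
    intro v hv hv0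
    rw [incCount_eq_zero]
    intro e he hve
    obtain ⟨u, hu, w, hw, -, rfl⟩ := hEdform _ he
    rcases Sym2.mem_iff.1 hve with rfl | rfl
    · exact hv hu
    · exact hv0 hw
  have hQzA : ∀ v ∈ Qz, v ∉ A := fun v hv => (hQ.1 (hQ₀.1 (hQz.1 hv).1).1).2.1
  have hEz1 : ∀ v ∈ Qz, incCount Ez v = 1 := fun v hv =>
    incCount_joinEdges_of_mem (fun w hw h => hQzA _ h (hzA w (hQz.1 hw).1)) hv
  have hEz0 : ∀ v ∉ A, v ∉ Qz → incCount Ez v = 0 := fun v hv hvz =>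
    incCount_joinEdges_eq_zero hvz (fun w hw h => hv (h ▸ hzA w (hQz.1 hw).1))
  have hEzR : ∀ v ∈ R, incCount Ez v = 0 := fun v hv =>
    incCount_joinEdges_eq_zero (fun h => hQzA v h (hRA hv))
      (fun w hw h => (hzf w (hQz.1 hw).1).2 (h ▸ hv))
  -- Distinct members of `Q` lie in distinct components of `Γ`, so no vertex of `A` receives two
  -- edges of `Ez`.
  have hEzA : ∀ z ∈ A, incCount Ez z = 0 ∨ (incCount Ez z = 1 ∧ ∃ v ∈ Qz, Γ.Adj v z) := by
    intro z hz
    have hzQ : z ∉ Qz := fun h => hQzA z h hz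
    by_cases h : ∃ v ∈ Qz, zf v = z
    · obtain ⟨v, hv, rfl⟩ := h
      refine Or.inr ⟨incCount_joinEdges_eq_one hzQ hv rfl fun v' hv' h' => ?_, v, hv,
        hzΓ v (hQz.1 hv).1⟩
      refine hQuniq v (hQ₀.1 (hQz.1 hv).1).1 v' (hQ₀.1 (hQz.1 hv').1).1 _
        (hzΓ v (hQz.1 hv).1) ?_
      rw [← h']
      exact hzΓ v' (hQz.1 hv').1
    · push Not at h
      exact Or.inl (incCount_joinEdges_eq_zero hzQ h)
  -- values
  set p : V → ℕ := fun v => x v + incCount (Eb ∪ Ed ∪ Ez) v with hp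
  have hpA : ∀ v ∈ S, v ∈ A → v ∉ R → p v = incCount Ez v := by
    intro v hvS hvA hvR
    have h1 : v ∉ Q := fun h => (hQ.1 h).2.1 hvA
    simp only [hp, hcount, hxR v hvS hvA hvR, hEb0 v hvR (fun h => h1 (hQ₂.1 h).1),
      hEd0 v hvR (fun h => h1 (hQ₀.1 h).1), zero_add]
  have hpR : ∀ v ∈ R, (p v : ZMod 2) = t (Λ.connectedComponentMk v) := by
    intro v hv
    rw [← hEdR v hv]
    simp only [hp, hcount, hEzR v hv]
    push_cast
    ring
  have hpB : ∀ v ∉ A, v ∉ Q₂ → v ∉ Q₀ → p v = 0 := by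
    intro v hvA h2 h0
    have hvR : v ∉ R := fun h => hvA (hRA h)
    simp only [hp, hcount, hx v hvA, hEb0 v hvR h2, hEd0 v hvR h0,
      hEz0 v hvA (fun h => h0 (hQz.1 h).1)]
  have hpQ₂ : ∀ v ∈ Q₂, p v = 1 := by
    intro v hv
    have hvA := (hQ.1 (hQ₂.1 hv).1).2.1
    have hvR : v ∉ R := fun h => hvA (hRA h)
    have h0 : v ∉ Q₀ := fun h => (hQ₂.1 hv).2 (hQ₀.1 h).2.1
    simp only [hp, hcount, hx v hvA, hEb1 v hv, hEd0 v hvR h0,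
      hEz0 v hvA (fun h => h0 (hQz.1 h).1)]
  have hpQ₀ : ∀ v ∈ Q₀, 1 ≤ incCount Ed v ∧ p v = incCount Ed v + incCount Ez v := by
    intro v hv
    have hvQ := (hQ₀.1 hv).1
    have hvA := (hQ.1 hvQ).2.1
    have hvR : v ∉ R := fun h => hvA (hRA h)
    have h2 : v ∉ Q₂ := fun h => (hQ₂.1 h).2 (hQ₀.1 hv).2.1
    refine ⟨hEd1 v hvR ⟨m v, (hm v hvQ).2, Or.inr ⟨(hm v hvQ).1, hv⟩⟩, ?_⟩
    simp only [hp, hcount, hx v hvA, hEb0 v hvR h2, zero_add]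
  have hpQ₀t : ∀ v ∈ Q₀, (p v : ZMod 2) ≠ t (Λ.connectedComponentMk v) := by
    intro v hv
    rw [(hpQ₀ v hv).2]
    by_cases hz : v ∈ Qz
    · rw [hEz1 v hz]
      push_cast
      rw [(hQz.1 hz).2]
      have : ∀ a : ZMod 2, a + 1 ≠ a := by decide
      exact this _
    · rw [hEz0 v (hQ.1 (hQ₀.1 hv).1).2.1 hz, add_zero]
      exact fun h => hz (hQz.2 ⟨hv, h⟩)
  have key : ∀ a ∈ S, ∀ b ∈ S, a ∈ A → b ∉ A → H.Adj a b → p a ≠ p b ∨ q a ≠ q b := by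
    intro a haS b hbS haA hbA hab
    have hqa := hqA a haS haA
    by_cases hbQ : b ∈ Q
    · by_cases hb2 : b ∈ Q₂
      · by_cases haR : a ∈ R
        · right
          rw [hqR a haR]
          exact (hQ₂.1 hb2).2.symm
        · left
          rw [hpQ₂ b hb2, hpA a haS haA haR]
          rcases hEzA a haA with h | ⟨-, v, hv, hva⟩
          · omega
          · exfalso
            have hv0 := (hQz.1 hv).1
            have := hQuniq b hbQ v (hQ₀.1 hv0).1 a ((hΓ b a).2 ⟨hab.symm, hbS, hQR b hbQ, haR⟩) hva
            rw [this] at hv0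
            exact (hQ₂.1 hb2).2 (hQ₀.1 hv0).2.1
      · by_cases hb0 : b ∈ Q₀
        · left
          by_cases haR : a ∈ R
          · intro h
            apply hpQ₀t b hb0
            rw [← h, hpR a haR]
            congr 1
            exact ConnectedComponent.sound
              (Adj.reachable (G := Λ) ⟨hab, Or.inl ⟨haR, hb0⟩⟩)
          · rw [(hpQ₀ b hb0).2, hpA a haS haA haR]
            have h1 := (hpQ₀ b hb0).1
            rcases hEzA a haA with h | ⟨h, v, hv, hva⟩
            · omega
            · have := hQuniq b hbQ v (hQ₀.1 (hQz.1 hv).1).1 a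
                ((hΓ b a).2 ⟨hab.symm, hbS, hQR b hbQ, haR⟩) hva
              rw [this] at hv
              rw [h, hEz1 b hv]
              omega
        · left
          rw [hpB b hbA hb2 hb0]
          have hqb : q b = 0 := by
            by_contra h
            exact hb2 (hQ₂.2 ⟨hbQ, h⟩)
          have hall : ∀ z, H.Adj b z → z ∈ R := by
            intro z hz
            by_contra hzR
            exact hb0 (hQ₀.2 ⟨hbQ, hqb, z, hz, hzR⟩)
          have hyb : y b = 0 := by
            simp only [hq] at hqb
            omega
          have := hleaf b hbS hbA hyb hall a hab.symm
          simp only [hp]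
          omega
    · right
      intro h
      rw [h] at hqa
      exact hbQ (hQ.2 ⟨hbS, hbA, hqa⟩)
  refine ⟨Eb ∪ Ed ∪ Ez, F, ?_, ?_, ?_, ?_⟩
  · rw [Finset.disjoint_left]
    intro e he heF
    have hFe : ∀ v ∈ e, v ∉ R := by
      rintro v hv hvR
      exact incCount_eq_zero.1 (hFR v (Or.inl hvR)) e heF hv
    rcases Finset.mem_union.1 he with he | he
    · rcases Finset.mem_union.1 he with he | he
      · obtain ⟨v, hv, rfl⟩ := mem_joinEdges.1 he
        exact hFe (m v) (by simp) (hm v (hQ₂.1 hv).1).1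
      · obtain ⟨u, hu, w, hw, -, rfl⟩ := hEdform _ he
        exact hFe u (by simp) hu
    · obtain ⟨v, hv, rfl⟩ := mem_joinEdges.1 he
      -- Since `q = 0` at `v`, no edge of `F` meets `v`.
      have h0 := (hQ₀.1 (hQz.1 hv).1).2.1
      simp only [hq] at h0
      exact incCount_eq_zero.1 (by omega : incCount F v = 0) _ heF (by simp)
  · have hadj : ∀ a b, a ∈ S → H.Adj a b →
        s(a, b) ∈ H.edgeSet ∧ ∀ v ∈ s(a, b), v ∈ S := by
      intro a b ha hab
      refine ⟨hab, fun v hv => ?_⟩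
      rcases Sym2.mem_iff.1 hv with rfl | rfl
      · exact ha
      · exact hS a ha _ hab
    intro e he
    simp only [Finset.mem_union] at he
    rcases he with ((he | he) | he) | he
    · obtain ⟨v, hv, rfl⟩ := mem_joinEdges.1 he
      have hvQ := (hQ₂.1 hv).1
      exact hadj v (m v) (hQ.1 hvQ).1 (hm v hvQ).2
    · obtain ⟨u, hu, w, hw, h, rfl⟩ := hEdform _ he
      exact hadj u w (hRS hu) h
    · obtain ⟨v, hv, rfl⟩ := mem_joinEdges.1 he
      have hv0 := (hQz.1 hv).1
      exact hadj v (zf v) (hQ.1 (hQ₀.1 hv0).1).1 (hzf v hv0).1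
    · have := hF e he
      induction e with
      | _ a b => exact hadj a b ((hΓ a b).1 this).2.1 this.1
  · intro v hvS
    change p v = 0 ∨ q v = 0 ∨ (p v = 1 ∧ Even (q v))
    by_cases hvA : v ∈ A
    · by_cases hvR : v ∈ R
      · exact Or.inr (Or.inl (hqR v hvR))
      · rw [hpA v hvS hvA hvR]
        rcases hEzA v hvA with h | ⟨h, -⟩
        · exact Or.inl h
        · exact Or.inr (Or.inr ⟨h, hqA v hvS hvA⟩)
    · by_cases h2 : v ∈ Q₂
      · exact Or.inr (Or.inr ⟨hpQ₂ v h2, (hQ.1 (hQ₂.1 h2).1).2.2⟩)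
      · by_cases h0 : v ∈ Q₀
        · exact Or.inr (Or.inl (hQ₀.1 h0).2.1)
        · exact Or.inl (hpB v hvA h2 h0)
  · intro a ha b hb hab
    change p a ≠ p b ∨ q a ≠ q b
    by_cases haA : a ∈ A
    · exact key a ha b hb haA ((hA a b hab).1 haA) hab
    · have hbA : b ∈ A := by
        have := hA a b hab
        tauto
      exact (key b hb a ha hbA haA hab.symm).imp Ne.symm Ne.symm

end Bipartite

/-! ### Components with a leaf, and the general bipartite case. -/

section Components

/-- The leaf `w` can be entered only from `u`, so a walk to `u` may stop there instead. -/
lemma Reachable.avoid_leaf {V : Type*} {H Γ : SimpleGraph V} {S : Set V} {a u w : V}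
    (hS : ∀ a ∈ S, ∀ b, H.Adj a b → b ∈ S)
    (hΓ : ∀ a b, Γ.Adj a b ↔ H.Adj a b ∧ a ∈ S ∧ a ≠ w ∧ b ≠ w)
    (hw : ∀ z, H.Adj w z → z = u) (h : H.Reachable a u) (ha : a ∈ S) (haw : a ≠ w) :
    Γ.Reachable a u := by
  obtain ⟨p⟩ := h
  induction p with
  | nil => exact Reachable.refl _
  | @cons a b u hadj p ih =>
    by_cases hb : b = w
    · subst hb
      rw [hw a hadj.symm]
    · exact ((hΓ a b).2 ⟨hadj, ha, haw, hb⟩).reachable.trans (ih hw (hS a ha b hadj) hb)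

variable {V : Type*} [DecidableEq V]

/-- Delete the leaf `w`; the rest stays connected, and `F` makes `q` odd on `A` and even off `A`,
with no control at the root `u` only. An odd count at `u` is fine. If it is even and positive, label
3 on `uw` makes it odd and at least 3, against 1 at `w`. If it is 0, labels 2 on `uw` and `uw'` give
`p = 2` at `u`, while `p ≤ 1` off `A`. -/
theorem separable_of_leaf [Fintype V] (H : SimpleGraph V) (S A : Set V) (x y : V → ℕ)
    (hS : ∀ a ∈ S, ∀ b, H.Adj a b → b ∈ S)
    (hA : ∀ a b, H.Adj a b → (a ∈ A ↔ b ∉ A))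
    (hconn : ∀ a ∈ S, ∀ b ∈ S, H.Reachable a b)
    (hx : ∀ v ∈ S, x v = 0) (hy : ∀ v ∈ A, y v = 0)
    {u w w' : V} (huS : u ∈ S) (huA : u ∈ A) (huw : H.Adj u w) (huw' : H.Adj u w') (hne : w' ≠ w)
    (hw : ∀ z, H.Adj w z → z = u) (hyw : y w = 0) :
    H.Separable S x y := by
  classical
  let Γ : SimpleGraph V :=
    { Adj := fun a b => H.Adj a b ∧ (a ∈ S ∧ b ∈ S) ∧ a ≠ w ∧ b ≠ w
      symm := ⟨fun a b h => ⟨h.1.symm, h.2.1.symm, h.2.2.2, h.2.2.1⟩⟩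
      loopless := ⟨fun a h => h.1.ne rfl⟩ }
  have hΓ : ∀ a b, Γ.Adj a b ↔ H.Adj a b ∧ a ∈ S ∧ a ≠ w ∧ b ≠ w := fun a b =>
    ⟨fun h => ⟨h.1, h.2.1.1, h.2.2⟩, fun h => ⟨h.1, ⟨h.2.1, hS a h.2.1 b h.1⟩, h.2.2⟩⟩
  have hreach : ∀ a ∈ S, a ≠ w → Γ.Reachable a u := fun a ha haw =>
    (hconn a ha u huS).avoid_leaf hS hΓ hw ha haw
  have hex : ∀ K : Γ.ConnectedComponent, ∃ r, Γ.connectedComponentMk r = K ∧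
      (K = Γ.connectedComponentMk u → r = u) := by
    intro K
    by_cases h : K = Γ.connectedComponentMk u
    · exact ⟨u, h.symm, fun _ => rfl⟩
    · obtain ⟨r, hr⟩ := K.exists_rep
      exact ⟨r, hr, fun h' => absurd h' h⟩
  choose root hroot hrootu using hex
  have hnr : ∀ a ∈ S, a ≠ w → a ≠ u → a ≠ root (Γ.connectedComponentMk a) := by
    intro a ha haw hau
    rw [hrootu _ (ConnectedComponent.sound (hreach a ha haw))]
    exact hau
  obtain ⟨F, hF, hc⟩ := exists_incCount_parity Γ root hroot (fun v => if v ∈ A then 1 else y v)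
  have hwA : w ∉ A := (hA u w huw).1 huA
  have hwA' : w' ∉ A := (hA u w' huw').1 huA
  have hwS : w ∈ S := hS u huS w huw
  have hwS' : w' ∈ S := hS u huS w' huw'
  have hFw : incCount F w = 0 := by
    rw [incCount_eq_zero]
    rintro e he ⟨z, rfl⟩
    exact (hF _ he).2.2.1 rfl
  have hodd : ∀ a ∈ S, a ∈ A → a ≠ u → Odd (y a + incCount F a) := by
    intro a ha haA hau
    have := hc a (hnr a ha (fun h => hwA (h ▸ haA)) hau)
    rw [if_pos haA, ZMod.natCast_eq_one_iff_odd] at this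
    rwa [hy a haA, zero_add]
  have heven : ∀ b ∈ S, b ∉ A → Even (y b + incCount F b) := by
    intro b hb hbA
    by_cases hbw : b = w
    · simp [hbw, hyw, hFw]
    · have hbu : b ≠ u := fun h => hbA (h ▸ huA)
      have := hc b (hnr b hb hbw hbu)
      rw [if_neg hbA] at this
      rw [← ZMod.natCast_eq_zero_iff_even]
      push_cast
      rw [this, CharTwo.add_self_eq_zero]
  have hyu := hy u huA
  have hFS : ∀ e ∈ F, e ∈ H.edgeSet ∧ ∀ v ∈ e, v ∈ S := by
    intro e he
    have := hF e he
    induction e with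
    | _ a b =>
      refine ⟨this.1, fun v hv => ?_⟩
      rcases Sym2.mem_iff.1 hv with rfl | rfl
      · exact this.2.1.1
      · exact this.2.1.2
  have huwS : ∀ z, H.Adj u z → s(u, z) ∈ H.edgeSet ∧ ∀ v ∈ s(u, z), v ∈ S := by
    refine fun z hz => ⟨hz, fun v hv => ?_⟩
    rcases Sym2.mem_iff.1 hv with rfl | rfl
    · exact huS
    · exact hS u huS _ hz
  have hsymm : ∀ E₂ E₃ : Finset (Sym2 V),
      (∀ a ∈ S, ∀ b ∈ S, a ∈ A → b ∉ A → H.Adj a b →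
        x a + incCount E₂ a ≠ x b + incCount E₂ b ∨ y a + incCount E₃ a ≠ y b + incCount E₃ b) →
      ∀ a ∈ S, ∀ b ∈ S, H.Adj a b →
        x a + incCount E₂ a ≠ x b + incCount E₂ b ∨ y a + incCount E₃ a ≠ y b + incCount E₃ b := by
    intro E₂ E₃ h a ha b hb hab
    by_cases haA : a ∈ A
    · exact h a ha b hb haA ((hA a b hab).1 haA) hab
    · have hbA : b ∈ A := by
        have := hA a b hab
        tauto
      exact (h b hb a ha hbA haA hab.symm).imp Ne.symm Ne.symm
  have hwF : ∀ z, s(w, z) ∉ F := fun z hz => incCount_eq_zero.1 hFw _ hz (by simp)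
  rcases Nat.even_or_odd (incCount F u) with hu | hu
  · by_cases hu0 : incCount F u = 0
    · -- both edges at `u` get the label `2`
      have h1 : s(u, w) ∉ ({s(u, w')} : Finset (Sym2 V)) := by
        simp only [Finset.mem_singleton]
        intro h
        exact hne (Sym2.congr_right.1 h).symm
      have hcnt : ∀ v, incCount {s(u, w), s(u, w')} v =
          (if v ∈ s(u, w) then 1 else 0) + (if v ∈ s(u, w') then 1 else 0) := fun v => by
        rw [incCount_insert h1, incCount_singleton]
      have hcu : incCount {s(u, w), s(u, w')} u = 2 := by simp [hcnt]
      have hcA : ∀ a ∈ A, a ≠ u → incCount {s(u, w), s(u, w')} a = 0 := by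
        intro a ha hau
        have h2 : a ≠ w := fun h => hwA (h ▸ ha)
        have h3 : a ≠ w' := fun h => hwA' (h ▸ ha)
        simp [hcnt, hau, h2, h3]
      have hcB : ∀ b ∉ A, incCount {s(u, w), s(u, w')} b ≤ 1 := by
        intro b hb
        have hbu : b ≠ u := fun h => hb (h ▸ huA)
        rw [hcnt]
        simp only [Sym2.mem_iff, hbu, false_or]
        split_ifs with h2 h3
        · exact absurd (h3.symm.trans h2) hne
        all_goals omega
      refine ⟨{s(u, w), s(u, w')}, F, ?_, ?_, ?_, hsymm _ _ ?_⟩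
      · rw [Finset.disjoint_left]
        intro e he heF
        refine incCount_eq_zero.1 hu0 e heF ?_
        rcases Finset.mem_insert.1 he with rfl | he
        · simp
        · rw [Finset.mem_singleton.1 he]
          simp
      · intro e he
        simp only [Finset.mem_union, Finset.mem_insert, Finset.mem_singleton] at he
        rcases he with (rfl | rfl) | he
        · exact huwS w huw
        · exact huwS w' huw'
        · exact hFS e he
      · intro v hv
        rw [hx v hv]
        by_cases hvA : v ∈ A
        · by_cases hvu : v = u
          · subst hvu
            exact Or.inr (Or.inl (by omega))
          · exact Or.inl (by rw [hcA v hvA hvu])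
        · have := hcB v hvA
          have := heven v hv hvA
          by_cases h0 : incCount {s(u, w), s(u, w')} v = 0
          · exact Or.inl (by omega)
          · exact Or.inr (Or.inr ⟨by omega, this⟩)
      · intro a ha b hb haA hbA hab
        by_cases hau : a = u
        · subst hau
          left
          rw [hx a ha, hx b hb, hcu]
          have := hcB b hbA
          omega
        · right
          have h1 := hodd a ha haA hau
          have h2 := heven b hb hbA
          intro h
          rw [h] at h1
          exact Nat.not_even_iff_odd.2 h1 h2
    · -- the edge to the leaf gets the label `3`
      have h1 : s(u, w) ∉ F := by
        rw [Sym2.eq_swap]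
        exact hwF u
      have hcnt : ∀ v, incCount (insert s(u, w) F) v =
          (if v ∈ s(u, w) then 1 else 0) + incCount F v := incCount_insert h1
      refine ⟨∅, insert s(u, w) F, by simp, ?_, ?_, hsymm _ _ ?_⟩
      · intro e he
        simp only [Finset.empty_union, Finset.mem_insert] at he
        rcases he with rfl | he
        · exact huwS w huw
        · exact hFS e he
      · intro v hv
        exact Or.inl (by simp [hx v hv])
      · intro a ha b hb haA hbA hab
        right
        have hbu : b ≠ u := fun h => hbA (h ▸ huA)
        have haw : a ≠ w := fun h => hwA (h ▸ haA)
        simp only [hcnt, Sym2.mem_iff, hbu, haw, false_or, or_false]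
        by_cases hau : a = u
        · subst hau
          by_cases hbw : b = w
          · subst hbw
            simp only [if_true]
            omega
          · have h2 := heven b hb hbA
            simp only [if_true, hbw, if_false]
            intro h
            rw [zero_add] at h
            rw [← h, hyu, zero_add] at h2
            have h3 : Odd (1 + incCount F a) := by
              rw [add_comm]
              exact hu.add_one
            exact Nat.not_even_iff_odd.2 h3 h2
        · have hbw : b ≠ w := fun h => hau (hw a (h ▸ hab.symm))
          simp only [hau, hbw, if_false, zero_add]
          have h1 := hodd a ha haA hau
          have h2 := heven b hb hbA
          intro h
          rw [h] at h1
          exact Nat.not_even_iff_odd.2 h1 h2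
  · refine ⟨∅, F, by simp, by simpa using hFS, fun v hv => Or.inl (by simp [hx v hv]),
      hsymm _ _ fun a ha b hb haA hbA hab => Or.inr fun h => ?_⟩
    have h1 : Odd (y a + incCount F a) := by
      by_cases hau : a = u
      · subst hau
        rwa [hyu, zero_add]
      · exact hodd a ha haA hau
    rw [h] at h1
    exact Nat.not_even_iff_odd.2 h1 (heven b hb hbA)

/-- If some vertices of `A` carry a factor 2, remove all of them. Otherwise use a suitable leaf off
`A` if there is one. Otherwise remove a single vertex of `A`: a leaf violating the condition for
removal would form an isolated edge with it, against `hiso`. -/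
theorem separable_of_reachable [Fintype V] (H : SimpleGraph V) (S A : Set V) (x y : V → ℕ)
    (hS : ∀ a ∈ S, ∀ b, H.Adj a b → b ∈ S)
    (hA : ∀ a b, H.Adj a b → (a ∈ A ↔ b ∉ A))
    (hconn : ∀ a ∈ S, ∀ b ∈ S, H.Reachable a b)
    (hx : ∀ v ∉ A, x v = 0) (hy : ∀ v ∈ A, y v = 0)
    (hiso : ∀ u ∈ A, ∀ v, H.Adj u v → (∀ z, H.Adj u z → z = v) → (∀ z, H.Adj v z → z = u) →
      x u ≠ 0 ∨ y v ≠ 0) :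
    H.Separable S x y := by
  by_cases hpos : ∃ u ∈ S, u ∈ A ∧ x u ≠ 0
  · refine separable_of_removal H S A {u | u ∈ S ∧ u ∈ A ∧ x u ≠ 0} x y hS hA hconn hx hy
      (fun u hu => hu.2.1) (fun u hu => hu.1) hpos ?_ ?_
    · intro v hv hvA hvR
      by_contra h
      exact hvR ⟨hv, hvA, h⟩
    · intro v hv hvA hyv hall z hz
      have := (hall z hz).2.2
      omega
  · push Not at hpos
    have hx0 : ∀ v ∈ S, x v = 0 := by
      intro v hv
      by_cases hvA : v ∈ A
      · exact hpos v hv hvA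
      · exact hx v hvA
    by_cases hl : ∃ u ∈ S, u ∈ A ∧ ∃ w w', H.Adj u w ∧ H.Adj u w' ∧ w' ≠ w ∧
        (∀ z, H.Adj w z → z = u) ∧ y w = 0
    · obtain ⟨u, huS, huA, w, w', h1, h2, h3, h4, h5⟩ := hl
      exact separable_of_leaf H S A x y hS hA hconn hx0 hy huS huA h1 h2 h3 h4 h5
    · by_cases hne : ∃ u ∈ S, u ∈ A
      · obtain ⟨u, huS, huA⟩ := hne
        refine separable_of_removal H S A {u} x y hS hA hconn hx hy (by simpa using huA)
          (by simpa using huS) ⟨u, rfl⟩ (fun v hv hvA _ => hpos v hv hvA) ?_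
        intro v hv hvA hyv hall z hz
        obtain rfl : z = u := hall z hz
        exfalso
        have hz0 := hpos z huS huA
        have hzv : ∀ w', H.Adj z w' → w' = v := by
          intro w' hw'
          by_contra hne
          exact hl ⟨z, huS, huA, v, w', hz.symm, hw', hne, hall, hyv⟩
        rcases hiso z huA v hz.symm hzv hall with h | h
        · exact h hz0
        · exact h hyv
      · push Not at hne
        refine ⟨∅, ∅, by simp, by simp, fun v hv => Or.inl (by simp [hx0 v hv]), ?_⟩
        intro a ha b hb hab
        exact absurd ((hA a b hab).2 (hne b hb)) (hne a ha)

theorem separable_univ [Fintype V] (H : SimpleGraph V) (A : Set V) (x y : V → ℕ)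
    (hA : ∀ a b, H.Adj a b → (a ∈ A ↔ b ∉ A))
    (hx : ∀ v ∉ A, x v = 0) (hy : ∀ v ∈ A, y v = 0)
    (hiso : ∀ u ∈ A, ∀ v, H.Adj u v → (∀ z, H.Adj u z → z = v) → (∀ z, H.Adj v z → z = u) →
      x u ≠ 0 ∨ y v ≠ 0) :
    H.Separable Set.univ x y := by
  classical
  have hcomp : ∀ K : H.ConnectedComponent, H.Separable K.supp x y := by
    intro K
    refine separable_of_reachable H K.supp A x y ?_ hA ?_ hx hy hiso
    · intro a ha b hab
      exact (ConnectedComponent.mem_supp_congr_adj K hab).1 ha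
    · intro a ha b hb
      exact ConnectedComponent.exact (ha.trans hb.symm)
  choose E₂ E₃ hdisj hE hval hne using hcomp
  have hmem : ∀ {K e v}, e ∈ E₂ K ∪ E₃ K → v ∈ e → H.connectedComponentMk v = K :=
    fun he hv => (hE _ _ he).2 _ hv
  have hcount : ∀ E : H.ConnectedComponent → Finset (Sym2 V),
      (∀ K, E K ⊆ E₂ K ∪ E₃ K) → ∀ v,
      incCount (Finset.univ.biUnion E) v = incCount (E (H.connectedComponentMk v)) v := by
    intro E hEsub v
    unfold incCount
    congr 1
    ext e
    simp only [Finset.mem_filter, Finset.mem_biUnion, Finset.mem_univ, true_and]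
    constructor
    · rintro ⟨⟨K, hK⟩, hv⟩
      rw [hmem (hEsub K hK) hv]
      exact ⟨hK, hv⟩
    · rintro ⟨h, hv⟩
      exact ⟨⟨_, h⟩, hv⟩
  have h2 := hcount E₂ fun K => Finset.subset_union_left
  have h3 := hcount E₃ fun K => Finset.subset_union_right
  refine ⟨Finset.univ.biUnion E₂, Finset.univ.biUnion E₃, ?_, ?_, ?_, ?_⟩
  · rw [Finset.disjoint_left]
    intro e he he'
    obtain ⟨K, -, hK⟩ := Finset.mem_biUnion.1 he
    obtain ⟨K', -, hK'⟩ := Finset.mem_biUnion.1 he'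
    obtain ⟨v, hv⟩ : ∃ v, v ∈ e := ⟨_, Sym2.out_fst_mem e⟩
    have e1 := hmem (Finset.mem_union_left _ hK) hv
    have e2 := hmem (Finset.mem_union_right _ hK') hv
    rw [← e1] at hK
    rw [← e2] at hK'
    exact Finset.disjoint_left.1 (hdisj _) hK hK'
  · intro e he
    refine ⟨?_, fun _ _ => Set.mem_univ _⟩
    rcases Finset.mem_union.1 he with he | he
    · obtain ⟨K, -, hK⟩ := Finset.mem_biUnion.1 he
      exact (hE K e (Finset.mem_union_left _ hK)).1
    · obtain ⟨K, -, hK⟩ := Finset.mem_biUnion.1 he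
      exact (hE K e (Finset.mem_union_right _ hK)).1
  · intro v _
    rw [h2, h3]
    exact hval _ v rfl
  · intro a _ b _ hab
    have hK : H.connectedComponentMk b = H.connectedComponentMk a :=
      ConnectedComponent.sound hab.symm.reachable
    rw [h2, h3, h2, h3, hK]
    exact hne _ a rfl b hK hab

end Components

/-! ### Proper colourings with least colour sum. -/

section MinSumColoring

/-- `u v` is an edge forming a component of the subgraph induced by the colours `1` and `2`. -/
def IsolatedPair {V : Type*} (G : SimpleGraph V) (c : V → ℕ) (u v : V) : Prop :=
  G.Adj u v ∧ c u ≤ 2 ∧ c v ≤ 2 ∧ (∀ z, G.Adj u z → c z ≤ 2 → z = v) ∧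
    ∀ z, G.Adj v z → c z ≤ 2 → z = u

lemma IsolatedPair.symm {V : Type*} {G : SimpleGraph V} {c : V → ℕ} {u v : V}
    (h : G.IsolatedPair c u v) : G.IsolatedPair c v u := ⟨h.1.symm, h.2.2.1, h.2.1, h.2.2.2.2, h.2.2.2.1⟩

variable {V : Type*} [Fintype V]

/-- A proper colouring by positive integers with the least possible sum of colours. -/
structure IsMinSumColoring (G : SimpleGraph V) (c : V → ℕ) : Prop where
  pos : ∀ v, 1 ≤ c v
  proper : ∀ a b, G.Adj a b → c a ≠ c b
  minimal : ∀ c' : V → ℕ, (∀ v, 1 ≤ c' v) → (∀ a b, G.Adj a b → c' a ≠ c' b) →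
    ∑ v, c v ≤ ∑ v, c' v

lemma exists_isMinSumColoring (G : SimpleGraph V) : ∃ c, G.IsMinSumColoring c := by
  classical
  have hex : ∃ n, ∃ c : V → ℕ, (∀ v, 1 ≤ c v) ∧ (∀ a b, G.Adj a b → c a ≠ c b) ∧ ∑ v, c v = n := by
    refine ⟨_, fun v => (Fintype.equivFin V v : ℕ) + 1, fun v => Nat.le_add_left 1 _, fun a b hab h => ?_, rfl⟩
    apply hab.ne
    apply (Fintype.equivFin V).injective
    apply Fin.ext
    simpa using h
  obtain ⟨c, h1, h2, h3⟩ := Nat.find_spec hex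
  exact ⟨c, h1, h2, fun c' h1' h2' => h3.le.trans (Nat.find_min' hex ⟨c', h1', h2', rfl⟩)⟩

/-- Otherwise recolouring `w` with `i` would lower the sum. -/
lemma IsMinSumColoring.exists_adj [DecidableEq V] {G : SimpleGraph V} {c : V → ℕ}
    (h : G.IsMinSumColoring c) {w : V} {i : ℕ} (hi : 1 ≤ i) (hiw : i < c w) :
    ∃ z, G.Adj w z ∧ c z = i := by
  by_contra! hcon
  have := h.minimal (Function.update c w i) (fun v => ?_) (fun a b hab => ?_)
  · refine absurd this (not_le.2 (Finset.sum_lt_sum (fun v _ => ?_) ⟨w, Finset.mem_univ _, ?_⟩))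
    · by_cases hv : v = w
      · subst hv
        simpa using hiw.le
      · simp [hv]
    · simpa using hiw
  · by_cases hv : v = w
    · subst hv
      simpa using hi
    · simpa [hv] using h.pos v
  · by_cases ha : a = w
    · subst ha
      rw [Function.update_self, Function.update_of_ne hab.ne']
      exact (hcon b hab).symm
    · by_cases hb : b = w
      · subst hb
        rw [Function.update_self, Function.update_of_ne ha]
        exact hcon a hab.symm
      · rw [Function.update_of_ne ha, Function.update_of_ne hb]
        exact h.proper a b hab

/-- The `c w / 2` colours `c w - 1, c w - 3, …` all occur among the neighbours of `w`. -/
lemma IsMinSumColoring.le_card_exact [DecidableEq V] {G : SimpleGraph V} [DecidableRel G.Adj]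
    {c : V → ℕ} (h : G.IsMinSumColoring c) (w : V) :
    c w / 2 ≤ #{z | G.Adj w z ∧ c z < c w ∧ (c z : ZMod 2) = c w + 1} := by
  have hinj : Set.InjOn (fun j => c w - 1 - 2 * j) (Finset.range (c w / 2) : Set ℕ) := by
    intro a ha b hb hab
    simp only [Finset.coe_range, Set.mem_Iio] at ha hb hab
    omega
  calc c w / 2 = #((Finset.range (c w / 2)).image fun j => c w - 1 - 2 * j) := by
        rw [Finset.card_image_of_injOn hinj, Finset.card_range]
    _ ≤ #((Finset.univ.filter fun z =>
          G.Adj w z ∧ c z < c w ∧ (c z : ZMod 2) = c w + 1).image c) := by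
        apply Finset.card_le_card
        intro i hi
        obtain ⟨j, hj, rfl⟩ := Finset.mem_image.1 hi
        rw [Finset.mem_range] at hj
        obtain ⟨z, hz, hcz⟩ := h.exists_adj (w := w) (i := c w - 1 - 2 * j) (by omega) (by omega)
        refine Finset.mem_image.2 ⟨z, Finset.mem_filter.2 ⟨Finset.mem_univ _, hz, by omega, ?_⟩, hcz⟩
        have : c w + 1 = c z + 2 * (j + 1) := by omega
        have h2 : ((c w + 1 : ℕ) : ZMod 2) = ((c z + 2 * (j + 1) : ℕ) : ZMod 2) := by rw [this]
        have h20 : (2 : ZMod 2) = 0 := rfl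
        push_cast at h2
        rw [h2, h20, zero_mul, add_zero]
    _ ≤ _ := Finset.card_image_le

end MinSumColoring

/-! ### Labelling downwards from the vertices of colour at least 3. -/

section HighClasses

variable {V : Type*} [Fintype V] [DecidableEq V]

/-- A partial labelling of the edges whose upper end (with respect to the colouring `c`) lies in
the set `D` of processed vertices. An edge in `E i` has a lower end whose colour has parity `i`;
it stands for a label `2` if `i = 1` and for a label `3` if `i = 0`. -/
structure IsPartialLabelling (G : SimpleGraph V) (c : V → ℕ) (E : ZMod 2 → Finset (Sym2 V))
    (D : Finset V) : Prop where
  minSum : G.IsMinSumColoring c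
  three_le : ∀ w ∈ D, 3 ≤ c w
  upper : ∀ w ∈ D, ∀ v ∉ D, c v ≤ c w
  edge : ∀ i, ∀ e ∈ E i, ∃ w ∈ D, ∃ z, G.Adj w z ∧ c z < c w ∧ (c z : ZMod 2) = i ∧ e = s(w, z)
  -- Only edges going down from `w` count here: an edge from above has `w` as its lower end and lies
  -- in `E (c w)`.
  exact : ∀ w ∈ D, incCount (E (c w + 1)) w = c w / 2
  flexPos : ∀ w ∈ D, 1 ≤ incCount (E (c w)) w
  -- Together with `exact`, this gives the total number of labelled edges at `w` the parity of `c w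
  -- + 1`.
  flexParity : ∀ w ∈ D, (incCount (E (c w)) w : ZMod 2) = (c w / 2 : ℕ) + c w + 1
  touch : ∀ u v, G.IsolatedPair c u v → (∃ w ∈ D, G.Adj w u ∨ G.Adj w v) →
    ∃ i, ∃ e ∈ E i, u ∈ e ∨ v ∈ e

lemma isPartialLabelling_empty {G : SimpleGraph V} {c : V → ℕ} (h : G.IsMinSumColoring c) :
    G.IsPartialLabelling c (fun _ => ∅) ∅ where
  minSum := h
  three_le := by simp
  upper := by simp
  edge := by simp
  exact := by simp
  flexPos := by simp
  flexParity := by simp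
  touch := by simp

/-- Exchanging the colours of an isolated pair keeps the colouring proper and its sum unchanged,
hence minimal; no labelled edge notices it. -/
lemma IsPartialLabelling.swap {G : SimpleGraph V} {c : V → ℕ} {E : ZMod 2 → Finset (Sym2 V)}
    {D : Finset V} (h : G.IsPartialLabelling c E D) {u v : V} (huv : G.IsolatedPair c u v)
    (hfree : ∀ i, ∀ e ∈ E i, u ∉ e ∧ v ∉ e) :
    G.IsPartialLabelling (c ∘ Equiv.swap u v) E D := by
  set c' := c ∘ Equiv.swap u v with hc'
  have hu : c' u = c v := by simp [hc']
  have hv : c' v = c u := by simp [hc']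
  have hz : ∀ z, z ≠ u → z ≠ v → c' z = c z := fun z h1 h2 => by
    simp [hc', Equiv.swap_apply_of_ne_of_ne h1 h2]
  have hle : ∀ z, c' z ≤ 2 ↔ c z ≤ 2 := by
    intro z
    have h1 := huv.2.1
    have h2 := huv.2.2.1
    by_cases hzu : z = u
    · subst hzu
      omega
    · by_cases hzv : z = v
      · subst hzv
        omega
      · rw [hz z hzu hzv]
  have hge : ∀ z, 3 ≤ c z → c' z = c z := by
    intro z h3
    refine hz z ?_ ?_
    · rintro rfl
      have := huv.2.1
      omega
    · rintro rfl
      have := huv.2.2.1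
      omega
  have hD : ∀ w ∈ D, c' w = c w := fun w hw => hge w (h.three_le w hw)
  have hpair : ∀ a b, G.IsolatedPair c' a b → G.IsolatedPair c a b := by
    rintro a b ⟨h1, h2, h3, h4, h5⟩
    exact ⟨h1, (hle a).1 h2, (hle b).1 h3, fun z hz hz2 => h4 z hz ((hle z).2 hz2),
      fun z hz hz2 => h5 z hz ((hle z).2 hz2)⟩
  have hproper : ∀ a b, G.Adj a b → c a ≤ 2 → c b ≤ 2 → c' a ≠ c' b := by
    intro a b hab ha hb
    by_cases hau : a = u
    · subst hau
      rw [huv.2.2.2.1 b hab hb, hu, hv]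
      exact (h.minSum.proper _ _ huv.1).symm
    · by_cases hav : a = v
      · subst hav
        rw [huv.2.2.2.2 b hab hb, hu, hv]
        exact h.minSum.proper _ _ huv.1
      · have hbu : b ≠ u := by
          rintro rfl
          exact hav (huv.2.2.2.1 a hab.symm ha)
        have hbv : b ≠ v := by
          rintro rfl
          exact hau (huv.2.2.2.2 a hab.symm ha)
        rw [hz a hau hav, hz b hbu hbv]
        exact h.minSum.proper _ _ hab
  refine ⟨⟨fun a => h.minSum.pos _, fun a b hab => ?_, fun c'' h1 h2 => ?_⟩, ?_, ?_, ?_, ?_, ?_,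
    ?_, ?_⟩
  · by_cases ha : c a ≤ 2
    · by_cases hb : c b ≤ 2
      · exact hproper a b hab ha hb
      · have := (hle a).2 ha
        have := hge b (by omega)
        omega
    · by_cases hb : c b ≤ 2
      · have := (hle b).2 hb
        have := hge a (by omega)
        omega
      · rw [hge a (by omega), hge b (by omega)]
        exact h.minSum.proper a b hab
  · have : ∑ a, c' a = ∑ a, c a := Equiv.sum_comp (Equiv.swap u v) c
    rw [this]
    exact h.minSum.minimal c'' h1 h2
  · intro w hw
    rw [hD w hw]
    exact h.three_le w hw
  · intro w hw z hzD
    rw [hD w hw]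
    by_cases hz2 : c z ≤ 2
    · have := (hle z).2 hz2
      have := h.three_le w hw
      omega
    · rw [hge z (by omega)]
      exact h.upper w hw z hzD
  · intro i e he
    obtain ⟨w, hw, z, hwz, hlt, hi, rfl⟩ := h.edge i e he
    have := hfree i _ he
    have hzz : c' z = c z := by
      apply hz
      · rintro rfl
        exact this.1 (by simp)
      · rintro rfl
        exact this.2 (by simp)
    exact ⟨w, hw, z, hwz, by rw [hzz, hD w hw]; exact hlt, by rw [hzz]; exact hi, rfl⟩
  · intro w hw
    rw [hD w hw]
    exact h.exact w hw
  · intro w hw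
    rw [hD w hw]
    exact h.flexPos w hw
  · intro w hw
    rw [hD w hw]
    exact h.flexParity w hw
  · exact fun a b hab => h.touch a b (hpair a b hab)

/-- `Xf` feeds the flexible count at `w` and `Xe` the exact one, which starts at 0. The new edges
end in `w` or at smaller colours, so counts on `D` do not change. -/
lemma IsPartialLabelling.extend {G : SimpleGraph V} {c : V → ℕ} {E : ZMod 2 → Finset (Sym2 V)}
    {D : Finset V} (h : G.IsPartialLabelling c E D) {w : V} (hwD : w ∉ D) (hw3 : 3 ≤ c w)
    (hmax : ∀ v ∉ D, c v ≤ c w) (Xf Xe : Finset V)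
    (hXf : ∀ z ∈ Xf, G.Adj w z ∧ c z < c w ∧ (c z : ZMod 2) = c w)
    (hXe : ∀ z ∈ Xe, G.Adj w z ∧ c z < c w ∧ (c z : ZMod 2) = c w + 1)
    (hcard : #Xe = c w / 2) (hpos : 1 ≤ incCount (E (c w)) w + #Xf)
    (hpar : ((incCount (E (c w)) w + #Xf : ℕ) : ZMod 2) = (c w / 2 : ℕ) + c w + 1)
    (htouch : ∀ u v, G.IsolatedPair c u v → (∀ i, ∀ e ∈ E i, u ∉ e ∧ v ∉ e) → G.Adj w u →
      (u ∈ Xf ∨ v ∈ Xf) ∨ (u ∈ Xe ∨ v ∈ Xe)) :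
    ∃ E', G.IsPartialLabelling c E' (insert w D) := by
  have hne : (c w : ZMod 2) + 1 ≠ c w := by
    have : ∀ a : ZMod 2, a + 1 ≠ a := by decide
    exact this _
  have hcases : ∀ i : ZMod 2, i = c w ∨ i = c w + 1 := by
    have : ∀ a i : ZMod 2, i = a ∨ i = a + 1 := by decide
    exact this _
  let X : ZMod 2 → Finset V := fun i => if i = c w then Xf else Xe
  have hX : ∀ i, ∀ z ∈ X i, G.Adj w z ∧ c z < c w ∧ (c z : ZMod 2) = i := by
    intro i z hz
    rcases hcases i with rfl | rfl
    · exact hXf z (by simpa [X] using hz)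
    · exact hXe z (by simpa [X] using hz)
  have hdisj : ∀ i, Disjoint (E i) (starEdges w (X i)) := by
    intro i
    rw [Finset.disjoint_left]
    intro e he he'
    obtain ⟨z, hz, rfl⟩ := mem_starEdges.1 he'
    obtain ⟨w', hw', z', -, hlt, -, heq⟩ := h.edge i _ he
    rcases Sym2.eq_iff.1 heq with ⟨rfl, -⟩ | ⟨rfl, rfl⟩
    · exact hwD hw'
    · have := (hX i _ hz).2.1
      omega
  have hcount : ∀ i v, incCount (E i ∪ starEdges w (X i)) v =
      incCount (E i) v + incCount (starEdges w (X i)) v := fun i v => incCount_union (hdisj i) v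
  have hold : ∀ i, ∀ v ∈ D, incCount (E i ∪ starEdges w (X i)) v = incCount (E i) v := by
    intro i v hv
    rw [hcount, Nat.add_eq_left, incCount_eq_zero]
    intro e he hve
    obtain ⟨z, hz, rfl⟩ := mem_starEdges.1 he
    rcases Sym2.mem_iff.1 hve with rfl | rfl
    · exact hwD hv
    · have := (hX i _ hz).2.1
      have := h.upper _ hv w hwD
      omega
  have hnew : ∀ i, incCount (E i ∪ starEdges w (X i)) w = incCount (E i) w + #(X i) := fun i => by
    rw [hcount, incCount_starEdges_center]
  have hzero : incCount (E (c w + 1)) w = 0 := by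
    rw [incCount_eq_zero]
    intro e he hwe
    obtain ⟨w', hw', z', -, hlt, hi, rfl⟩ := h.edge _ _ he
    rcases Sym2.mem_iff.1 hwe with rfl | rfl
    · exact hwD hw'
    · exact hne hi.symm
  have hXcw : X (c w) = Xf := by simp [X]
  have hXcw' : X (c w + 1) = Xe := by simp [X]
  refine ⟨fun i => E i ∪ starEdges w (X i), h.minSum, ?_, ?_, ?_, ?_, ?_, ?_, ?_⟩
  · intro v hv
    rcases Finset.mem_insert.1 hv with rfl | hv
    · exact hw3
    · exact h.three_le v hv
  · intro v hv z hz
    rw [Finset.mem_insert, not_or] at hz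
    rcases Finset.mem_insert.1 hv with rfl | hv
    · exact hmax z hz.2
    · exact h.upper v hv z hz.2
  · intro i e he
    rcases Finset.mem_union.1 he with he | he
    · obtain ⟨w', hw', h'⟩ := h.edge i e he
      exact ⟨w', Finset.mem_insert_of_mem hw', h'⟩
    · obtain ⟨z, hz, rfl⟩ := mem_starEdges.1 he
      obtain ⟨h1, h2, h3⟩ := hX i z hz
      exact ⟨w, Finset.mem_insert_self _ _, z, h1, h2, h3, rfl⟩
  · intro v hv
    rcases Finset.mem_insert.1 hv with rfl | hv
    · rw [hnew, hzero, hXcw', zero_add, hcard]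
    · rw [hold _ v hv]
      exact h.exact v hv
  · intro v hv
    rcases Finset.mem_insert.1 hv with rfl | hv
    · rw [hnew, hXcw]
      exact hpos
    · rw [hold _ v hv]
      exact h.flexPos v hv
  · intro v hv
    rcases Finset.mem_insert.1 hv with rfl | hv
    · rw [hnew, hXcw]
      exact hpar
    · rw [hold _ v hv]
      exact h.flexParity v hv
  · intro u v huv hadj
    by_cases hfree : ∀ i, ∀ e ∈ E i, u ∉ e ∧ v ∉ e
    · have hw' : G.Adj w u ∨ G.Adj w v := by
        obtain ⟨w', hw', hadj⟩ := hadj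
        rcases Finset.mem_insert.1 hw' with rfl | hw'
        · exact hadj
        · obtain ⟨i, e, he, hue⟩ := h.touch u v huv ⟨w', hw', hadj⟩
          have := hfree i e he
          tauto
      have hmem : ∃ i, u ∈ X i ∨ v ∈ X i := by
        have : (u ∈ Xf ∨ v ∈ Xf) ∨ (u ∈ Xe ∨ v ∈ Xe) := by
          rcases hw' with hw' | hw'
          · exact htouch u v huv hfree hw'
          · have := htouch v u huv.symm (fun i e he => (hfree i e he).symm) hw'
            tauto
        rcases this with h1 | h1
        · exact ⟨c w, by rwa [hXcw]⟩
        · exact ⟨c w + 1, by rwa [hXcw']⟩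
      obtain ⟨i, hi | hi⟩ := hmem
      · exact ⟨i, s(w, u), Finset.mem_union_right _ (mem_starEdges.2 ⟨u, hi, rfl⟩), by simp⟩
      · exact ⟨i, s(w, v), Finset.mem_union_right _ (mem_starEdges.2 ⟨v, hi, rfl⟩), by simp⟩
    · push Not at hfree
      obtain ⟨i, e, he, hue⟩ := hfree
      exact ⟨i, e, Finset.mem_union_left _ he, by tauto⟩

lemma IsPartialLabelling.exists_step {G : SimpleGraph V} {c : V → ℕ}
    {E : ZMod 2 → Finset (Sym2 V)} {D : Finset V} (h : G.IsPartialLabelling c E D) {w : V}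
    (hwD : w ∉ D) (hw3 : 3 ≤ c w) (hmax : ∀ v ∉ D, c v ≤ c w) :
    ∃ c' E', G.IsPartialLabelling c' E' (insert w D) := by
  classical
  obtain ⟨k, hk⟩ : ∃ k, c w = k := ⟨_, rfl⟩
  rw [hk] at hw3 hmax
  -- `φ` is the colour among 1 and 2 that has the parity of `k`.
  obtain ⟨φ, hφ⟩ : ∃ φ, φ = 2 - k % 2 := ⟨_, rfl⟩
  have hφk : (φ : ZMod 2) = k := by
    have : ((φ + 2 * (k / 2 + k % 2) : ℕ) : ZMod 2) = ((k + 2 : ℕ) : ZMod 2) := by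
      congr 1
      omega
    have h20 : (2 : ZMod 2) = 0 := rfl
    push_cast at this
    rwa [h20, zero_mul, add_zero, add_zero] at this
  -- choose the colouring with as many neighbours of `w` of colour `φ` as possible
  let P : (V → ℕ) → Prop := fun c' =>
    G.IsPartialLabelling c' E D ∧ c' w = k ∧ ∀ v ∉ D, c' v ≤ k
  let N : (V → ℕ) → Finset V := fun c' => {z | G.Adj w z ∧ c' z = φ}
  have hN : ∀ {c' z}, z ∈ N c' ↔ G.Adj w z ∧ c' z = φ := by simp [N]
  obtain ⟨c, hP, hbest⟩ : ∃ c', P c' ∧ ∀ c'', P c'' → #(N c'') ≤ #(N c') := by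
    have hex : ∃ n, ∃ c', P c' ∧ Fintype.card V - #(N c') = n := ⟨_, c, ⟨h, hk, hmax⟩, rfl⟩
    obtain ⟨c', h1, h2⟩ := Nat.find_spec hex
    refine ⟨c', h1, fun c'' h'' => ?_⟩
    have h3 := Nat.find_min' hex ⟨c'', h'', rfl⟩
    have h4 := Finset.card_le_univ (N c'')
    have h5 := Finset.card_le_univ (N c')
    omega
  clear h hk hmax
  obtain ⟨h, hk, hmax⟩ := hP
  have hswap : ∀ u v, G.IsolatedPair c u v → (∀ i, ∀ e ∈ E i, u ∉ e ∧ v ∉ e) →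
      P (c ∘ Equiv.swap u v) := by
    intro u v huv hfree
    have h1 := huv.2.1
    have h2 := huv.2.2.1
    refine ⟨h.swap huv hfree, ?_, fun z hz => ?_⟩
    · rw [Function.comp_apply, Equiv.swap_apply_of_ne_of_ne, hk]
      · rintro rfl
        omega
      · rintro rfl
        omega
    · by_cases hzu : z = u
      · subst hzu
        simp only [Function.comp_apply, Equiv.swap_apply_left]
        omega
      · by_cases hzv : z = v
        · subst hzv
          simp only [Function.comp_apply, Equiv.swap_apply_right]
          omega
        · rw [Function.comp_apply, Equiv.swap_apply_of_ne_of_ne hzu hzv]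
          exact hmax z hz
  have hcol : ∀ u v, G.IsolatedPair c u v → c u = φ ∨ c v = φ := by
    intro u v huv
    have h1 := huv.2.1
    have h2 := huv.2.2.1
    have h3 := h.minSum.pos u
    have h4 := h.minSum.pos v
    have h5 := h.minSum.proper u v huv.1
    omega
  -- If neither end were in `N c`, exchanging the two colours would give `u` the colour `φ` and
  -- enlarge `N c`.
  have hend : ∀ u v, G.IsolatedPair c u v → (∀ i, ∀ e ∈ E i, u ∉ e ∧ v ∉ e) → G.Adj w u →
      u ∈ N c ∨ v ∈ N c := by
    intro u v huv hfree hwu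
    by_contra! hcon
    have hcu : c u ≠ φ := fun h => hcon.1 (hN.2 ⟨hwu, h⟩)
    have hcv : c v = φ := (hcol u v huv).resolve_left hcu
    have hss : insert u (N c) ⊆ N (c ∘ Equiv.swap u v) := by
      intro z hz
      rcases Finset.mem_insert.1 hz with rfl | hzN
      · exact hN.2 ⟨hwu, by simpa using hcv⟩
      · have hzu : z ≠ u := fun e => hcon.1 (e ▸ hzN)
        have hzv : z ≠ v := fun e => hcon.2 (e ▸ hzN)
        refine hN.2 ⟨(hN.1 hzN).1, ?_⟩
        rw [Function.comp_apply, Equiv.swap_apply_of_ne_of_ne hzu hzv]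
        exact (hN.1 hzN).2
    have h1 := Finset.card_le_card hss
    rw [Finset.card_insert_of_notMem hcon.1] at h1
    have h2 := hbest _ (hswap u v huv hfree)
    omega
  have hNf : ∀ z ∈ N c, G.Adj w z ∧ c z < k ∧ (c z : ZMod 2) = k := by
    intro z hz
    obtain ⟨h1, h2⟩ := hN.1 hz
    exact ⟨h1, by omega, by rw [h2, hφk]⟩
  have hNne : (N c).Nonempty := by
    obtain ⟨z, h1, h2⟩ := h.minSum.exists_adj (w := w) (i := φ) (by omega) (by omega)
    exact ⟨z, hN.2 ⟨h1, h2⟩⟩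
  have hNpos : 1 ≤ #(N c) := Finset.card_pos.2 hNne
  have hexact := h.minSum.le_card_exact w
  by_cases hpar : ((incCount (E k) w + #(N c) : ℕ) : ZMod 2) = (k / 2 : ℕ) + k + 1
  · obtain ⟨Xe, hXes, hcard⟩ := Finset.exists_subset_card_eq hexact
    refine ⟨c, h.extend hwD (by omega) (by rwa [hk]) (N c) Xe (by rwa [hk])
      (fun z hz => by simpa using hXes hz) hcard (by omega) (by rwa [hk])
      fun u v huv hfree hwu => Or.inl (hend u v huv hfree hwu)⟩
  have hpar1 : ((incCount (E k) w + #(N c) : ℕ) : ZMod 2) + 1 = (k / 2 : ℕ) + k + 1 := by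
    have : ∀ a b : ZMod 2, a ≠ b → a + 1 = b := by decide
    exact this _ _ hpar
  -- The parity is off by one. For `k ≥ 5` a further neighbour, of colour `φ + 2 < k`, repairs it;
  -- for `k = 3, 4` one has `φ + 2 = k`, and a member of `N c` is dropped instead.
  by_cases hk5 : 5 ≤ k
  · obtain ⟨z', hwz', hcz'⟩ := h.minSum.exists_adj (w := w) (i := φ + 2) (by omega) (by omega)
    have hz' : z' ∉ N c := fun hz => by
      have := (hN.1 hz).2
      omega
    obtain ⟨Xe, hXes, hcard⟩ := Finset.exists_subset_card_eq hexact
    refine ⟨c, h.extend hwD (by omega) (by rwa [hk]) (insert z' (N c)) Xe ?_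
      (fun z hz => by simpa using hXes hz) hcard ?_ ?_
      fun u v huv hfree hwu => Or.inl ?_⟩
    · intro z hz
      rcases Finset.mem_insert.1 hz with rfl | hz
      · refine ⟨hwz', by omega, ?_⟩
        have h20 : (2 : ZMod 2) = 0 := rfl
        rw [hcz', hk]
        push_cast
        rw [h20, add_zero, hφk]
      · rw [hk]
        exact hNf z hz
    · rw [Finset.card_insert_of_notMem hz']
      omega
    · rw [Finset.card_insert_of_notMem hz', hk, ← hpar1]
      push_cast
      ring
    · exact (hend u v huv hfree hwu).imp (Finset.mem_insert_of_mem) (Finset.mem_insert_of_mem)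
  · obtain ⟨z₀, hz₀⟩ := hNne
    have herase : #((N c).erase z₀) + 1 = #(N c) := Finset.card_erase_add_one hz₀
    have hpar2 : ((incCount (E k) w + #((N c).erase z₀) : ℕ) : ZMod 2) = (k / 2 : ℕ) + k + 1 := by
      rw [← hpar1, ← herase]
      push_cast
      have : ∀ a b : ZMod 2, a + b = a + (b + 1) + 1 := by decide
      exact this _ _
    -- For `k = 3` and `k = 4` the prescribed parity is odd, so the count cannot have dropped to 0.
    have hpos : 1 ≤ incCount (E k) w + #((N c).erase z₀) := by
      by_contra h0
      have h0 : incCount (E k) w + #((N c).erase z₀) = 0 := by omega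
      rw [h0] at hpar2
      obtain rfl | rfl : k = 3 ∨ k = 4 := by omega
      all_goals exact absurd hpar2 (by decide)
    -- If dropping `z₀` would leave its isolated pair untouched, exchange the colours of the pair:
    -- `z₀` then has the parity required in `Xe` and is put there.
    by_cases hiso : ∃ v, G.IsolatedPair c z₀ v ∧ ∀ i, ∀ e ∈ E i, z₀ ∉ e ∧ v ∉ e
    · obtain ⟨v, hpair, hfree₀⟩ := hiso
      obtain ⟨h', hk', hmax'⟩ := hswap z₀ v hpair hfree₀
      have hcz₀ := (hN.1 hz₀).2
      have hcv : c v ≠ φ := fun hcv =>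
        h.minSum.proper _ _ hpair.1 (hcz₀.trans hcv.symm)
      have hother : ∀ z ∈ (N c).erase z₀, (c ∘ Equiv.swap z₀ v) z = c z := by
        intro z hz
        obtain ⟨h1, h2⟩ := Finset.mem_erase.1 hz
        rw [Function.comp_apply, Equiv.swap_apply_of_ne_of_ne h1]
        rintro rfl
        exact hcv (hN.1 h2).2
      have hpair' : ∀ a b, G.IsolatedPair (c ∘ Equiv.swap z₀ v) a b → G.IsolatedPair c a b := by
        have hle : ∀ z, (c ∘ Equiv.swap z₀ v) z ≤ 2 ↔ c z ≤ 2 := by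
          intro z
          have h1 := hpair.2.1
          have h2 := hpair.2.2.1
          rw [Function.comp_apply]
          by_cases e1 : z = z₀
          · subst e1
            rw [Equiv.swap_apply_left]
            omega
          · by_cases e2 : z = v
            · subst e2
              rw [Equiv.swap_apply_right]
              omega
            · rw [Equiv.swap_apply_of_ne_of_ne e1 e2]
        rintro a b ⟨h1, h2, h3, h4, h5⟩
        exact ⟨h1, (hle a).1 h2, (hle b).1 h3, fun z hz hz2 => h4 z hz ((hle z).2 hz2),
          fun z hz hz2 => h5 z hz ((hle z).2 hz2)⟩
      have hexact' := h'.minSum.le_card_exact w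
      rw [hk'] at hexact'
      have hz₀mem : z₀ ∈ ({z | G.Adj w z ∧ (c ∘ Equiv.swap z₀ v) z < k ∧
          ((c ∘ Equiv.swap z₀ v) z : ZMod 2) = k + 1} : Finset V) := by
        have h1 := hpair.2.2.1
        have h2 := h.minSum.pos v
        simp only [Finset.mem_filter, Finset.mem_univ, true_and, Function.comp_apply,
          Equiv.swap_apply_left]
        refine ⟨(hN.1 hz₀).1, by omega, ?_⟩
        have h3 : c v + 2 * φ = φ + 3 := by
          interval_cases hh : c v <;> omega
        have h4 : ((c v + 2 * φ : ℕ) : ZMod 2) = ((φ + 3 : ℕ) : ZMod 2) := by rw [h3]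
        have h20 : (2 : ZMod 2) = 0 := rfl
        have h31 : (3 : ZMod 2) = 1 := rfl
        push_cast at h4
        rw [h20, zero_mul, add_zero, hφk, h31] at h4
        exact h4
      obtain ⟨Xe, hsub, hXes, hcard⟩ := Finset.exists_subsuperset_card_eq
        (Finset.singleton_subset_iff.2 hz₀mem) (by rw [Finset.card_singleton]; omega) hexact'
      refine ⟨_, h'.extend hwD (by omega) (by rwa [hk']) ((N c).erase z₀) Xe ?_ ?_ (by rwa [hk'])
        (by rwa [hk']) (by rwa [hk']) ?_⟩
      · intro z hz
        rw [hother z hz, hk']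
        exact hNf z (Finset.mem_of_mem_erase hz)
      · intro z hz
        rw [hk']
        simpa using hXes hz
      · intro a b hab hfree hwa
        have hz₀Xe : z₀ ∈ Xe := hsub (Finset.mem_singleton_self _)
        rcases hend a b (hpair' a b hab) hfree hwa with hm | hm
        · by_cases e : a = z₀
          · exact Or.inr (Or.inl (e ▸ hz₀Xe))
          · exact Or.inl (Or.inl (Finset.mem_erase.2 ⟨e, hm⟩))
        · by_cases e : b = z₀
          · exact Or.inr (Or.inr (e ▸ hz₀Xe))
          · exact Or.inl (Or.inr (Finset.mem_erase.2 ⟨e, hm⟩))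
    · push Not at hiso
      obtain ⟨Xe, hXes, hcard⟩ := Finset.exists_subset_card_eq hexact
      refine ⟨c, h.extend hwD (by omega) (by rwa [hk]) ((N c).erase z₀) Xe ?_
        (fun z hz => by simpa using hXes hz) hcard (by rwa [hk]) (by rwa [hk])
        fun a b hab hfree hwa => Or.inl ?_⟩
      · intro z hz
        rw [hk]
        exact hNf z (Finset.mem_of_mem_erase hz)
      · rcases hend a b hab hfree hwa with hm | hm
        · refine Or.inl (Finset.mem_erase.2 ⟨?_, hm⟩)
          rintro rfl
          obtain ⟨i, e, he, h1⟩ := hiso b hab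
          exact (hfree i e he).2 (h1 (hfree i e he).1)
        · refine Or.inr (Finset.mem_erase.2 ⟨?_, hm⟩)
          rintro rfl
          obtain ⟨i, e, he, h1⟩ := hiso a hab.symm
          exact (hfree i e he).1 (h1 (hfree i e he).2)

theorem exists_isPartialLabelling (G : SimpleGraph V) :
    ∃ c E D, G.IsPartialLabelling c E D ∧ ∀ v, 3 ≤ c v → v ∈ D := by
  classical
  suffices H : ∀ n c E D, G.IsPartialLabelling c E D → #(Finset.univ \ D) = n →
      ∃ c E D, G.IsPartialLabelling c E D ∧ ∀ v, 3 ≤ c v → v ∈ D by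
    obtain ⟨c, hc⟩ := exists_isMinSumColoring G
    exact H _ c _ _ (isPartialLabelling_empty hc) rfl
  intro n
  induction n with
  | zero =>
    intro c E D h h0
    refine ⟨c, E, D, h, fun v _ => ?_⟩
    rw [Finset.card_eq_zero, Finset.sdiff_eq_empty_iff_subset] at h0
    exact h0 (Finset.mem_univ v)
  | succ n ih =>
    intro c E D h hn
    by_cases hall : ∀ v, 3 ≤ c v → v ∈ D
    · exact ⟨c, E, D, h, hall⟩
    · push Not at hall
      obtain ⟨v, hv3, hvD⟩ := hall
      obtain ⟨w, hw, hmax⟩ := Finset.exists_max_image (Finset.univ \ D) c ⟨v, by simp [hvD]⟩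
      have hwD : w ∉ D := (Finset.mem_sdiff.1 hw).2
      have hmax' : ∀ z ∉ D, c z ≤ c w := fun z hz => hmax z (by simp [hz])
      obtain ⟨c', E', h'⟩ := h.exists_step hwD (hv3.trans (hmax' v hvD)) hmax'
      refine ih c' E' _ h' ?_
      rw [Finset.sdiff_insert, Finset.card_erase_of_mem hw, hn]
      rfl

end HighClasses

/-! ### Assembling the labelling from the high and low parts. -/

section Labelling

lemma IsNice.exists_third {V : Type*} {G : SimpleGraph V} (h : G.IsNice) {u v : V}
    (huv : G.Adj u v) : ∃ w, w ≠ u ∧ w ≠ v ∧ (G.Adj w u ∨ G.Adj w v) := by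
  classical
  by_contra! hcon
  have hu : ∀ z, G.Adj u z → z = v := fun z hz => by
    by_contra hzv
    exact (hcon z hz.ne' hzv).1 hz.symm
  have hv : ∀ z, G.Adj v z → z = u := fun z hz => by
    by_contra hzu
    exact (hcon z hzu hz.ne').2 hz.symm
  have hwalk : ∀ a z, G.Walk a z → (a = u ∨ a = v) → (z = u ∨ z = v) := by
    intro a z p
    induction p with
    | nil => exact id
    | cons hadj p ih =>
      rintro (rfl | rfl)
      · exact ih (Or.inr (hu _ hadj))
      · exact ih (Or.inl (hv _ hadj))
  have hsupp : ∀ z : (G.connectedComponentMk u), (z : V) = u ∨ (z : V) = v := by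
    rintro ⟨z, hz⟩
    obtain ⟨p⟩ := ConnectedComponent.exact hz
    exact hwalk u z p.reverse (Or.inl rfl)
  have hvmem : v ∈ G.connectedComponentMk u := ConnectedComponent.sound huv.symm.reachable
  have humem : u ∈ G.connectedComponentMk u := rfl
  refine (h (G.connectedComponentMk u)).false ⟨⟨fun z => if (z : V) = u then 0 else 1,
    fun i => if i = 0 then ⟨u, humem⟩ else ⟨v, hvmem⟩, ?_, ?_⟩, ?_⟩
  · intro z
    rcases hsupp z with hz | hz
    · exact Subtype.ext (by simp [hz])
    · exact Subtype.ext (by simp [hz, huv.ne'])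
  · intro i
    fin_cases i <;> simp [huv.ne']
  · intro a b
    have hadj : (G.connectedComponentMk u).toSimpleGraph.Adj a b ↔ G.Adj a b := Iff.rfl
    rw [hadj]
    rcases hsupp a with ha | ha <;> rcases hsupp b with hb | hb <;>
      simp [ha, hb, huv, huv.symm, huv.ne']

variable {V : Type*} [Fintype V] [DecidableEq V]

theorem IsNice.exists_edge_sets {G : SimpleGraph V} (h : G.IsNice) :
    ∃ E₂ E₃ : Finset (Sym2 V), Disjoint E₂ E₃ ∧ (∀ e ∈ E₂ ∪ E₃, e ∈ G.edgeSet) ∧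
      ∀ a b, G.Adj a b → incCount E₂ a ≠ incCount E₂ b ∨ incCount E₃ a ≠ incCount E₃ b := by
  obtain ⟨c, E, D, hP, hD⟩ := G.exists_isPartialLabelling
  have hDiff : ∀ w, w ∈ D ↔ 3 ≤ c w := fun w => ⟨hP.three_le w, hD w⟩
  let H : SimpleGraph V :=
    { Adj := fun a b => G.Adj a b ∧ c a ≤ 2 ∧ c b ≤ 2
      symm := ⟨fun a b h => ⟨h.1.symm, h.2.symm⟩⟩
      loopless := ⟨fun a h => h.1.ne rfl⟩ }
  have hlow : ∀ v, c v ≤ 2 → c v = 1 ∨ c v = 2 := fun v hv => by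
    have := hP.minSum.pos v
    omega
  have hparity : ∀ v, c v ≤ 2 → ∀ i, ∀ e ∈ E i, v ∈ e → (c v : ZMod 2) = i := by
    intro v hv i e he hve
    obtain ⟨w, hw, z, -, -, hi, rfl⟩ := hP.edge i e he
    rcases Sym2.mem_iff.1 hve with rfl | rfl
    · have := hP.three_le _ hw
      omega
    · exact hi
  have h10 : ∀ v, c v = 1 → incCount (E 0) v = 0 := by
    intro v hv
    rw [incCount_eq_zero]
    intro e he hve
    have := hparity v (by omega) 0 e he hve
    rw [hv] at this
    exact absurd this (by decide)
  have h21 : ∀ v, c v = 2 → incCount (E 1) v = 0 := by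
    intro v hv
    rw [incCount_eq_zero]
    intro e he hve
    have := hparity v (by omega) 1 e he hve
    rw [hv] at this
    exact absurd this (by decide)
  -- Restricting to one colour changes nothing on low vertices and supplies the zeros that
  -- `separable_univ` requires on all of `V`.
  let x : V → ℕ := fun v => if c v = 1 then incCount (E 1) v else 0
  let y : V → ℕ := fun v => if c v = 2 then incCount (E 0) v else 0
  have hx : ∀ v, c v ≤ 2 → x v = incCount (E 1) v := by
    intro v hv
    rcases hlow v hv with h1 | h2
    · simp [x, h1]
    · simp [x, h2, h21 v h2]
  have hy : ∀ v, c v ≤ 2 → y v = incCount (E 0) v := by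
    intro v hv
    rcases hlow v hv with h1 | h2
    · simp [y, h1, h10 v h1]
    · simp [y, h2]
  obtain ⟨F₂, F₃, hdisj, hF, hval, hne⟩ := separable_univ H {v | c v = 1} x y (by
      rintro a b ⟨hab, ha, hb⟩
      have h1 := hP.minSum.proper a b hab
      rcases hlow a ha with h2 | h2 <;> rcases hlow b hb with h3 | h3 <;> simp_all)
    (fun v hv => if_neg hv) (fun v (hv : c v = 1) => if_neg (by rw [hv]; decide)) (by
      rintro u hu v ⟨huv, hu2, hv2⟩ hu' hv'
      have hpair : G.IsolatedPair c u v := ⟨huv, hu2, hv2, fun z hz hz2 => hu' z ⟨hz, hu2, hz2⟩,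
        fun z hz hz2 => hv' z ⟨hz, hv2, hz2⟩⟩
      obtain ⟨w, hwu, hwv, hadj⟩ := h.exists_third huv
      have hwD : w ∈ D := by
        rw [hDiff]
        by_contra hw
        rcases hadj with hadj | hadj
        · exact hwv (hpair.2.2.2.1 w hadj.symm (by omega))
        · exact hwu (hpair.2.2.2.2 w hadj.symm (by omega))
      obtain ⟨i, e, he, hmem⟩ := hP.touch u v hpair ⟨w, hwD, hadj⟩
      have hcu : c u = 1 := hu
      have hcv : c v = 2 := (hlow v hv2).resolve_left fun h1 =>
        hP.minSum.proper u v huv (hcu.trans h1.symm)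
      rw [hx u hu2, hy v hv2]
      rcases hmem with hmem | hmem
      · left
        have hi := hparity u hu2 i e he hmem
        rw [hcu, Nat.cast_one] at hi
        exact (incCount_pos.2 ⟨e, hi ▸ he, hmem⟩).ne'
      · right
        have hi := hparity v hv2 i e he hmem
        have h20 : ((2 : ℕ) : ZMod 2) = 0 := rfl
        rw [hcv, h20] at hi
        exact (incCount_pos.2 ⟨e, hi ▸ he, hmem⟩).ne')
  have hEnot : ∀ i, ∀ e ∈ E i, ∃ w ∈ e, 3 ≤ c w := by
    intro i e he
    obtain ⟨w, hw, z, -, -, -, rfl⟩ := hP.edge i e he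
    exact ⟨w, by simp, hP.three_le w hw⟩
  have hFlow : ∀ e ∈ F₂ ∪ F₃, ∀ w ∈ e, c w ≤ 2 := by
    intro e he w hw
    obtain ⟨z, rfl⟩ := hw
    exact (hF _ he).1.2.1
  have hEF : ∀ i, ∀ F ⊆ F₂ ∪ F₃, Disjoint (E i) F := by
    intro i F hFs
    rw [Finset.disjoint_left]
    intro e he heF
    obtain ⟨w, hw, hw3⟩ := hEnot i e he
    have := hFlow e (hFs heF) w hw
    omega
  have hE01 : Disjoint (E 1) (E 0) := by
    rw [Finset.disjoint_left]
    intro e he he'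
    obtain ⟨w, -, z, -, hlt, hi, rfl⟩ := hP.edge 1 e he
    obtain ⟨w', -, z', -, hlt', hi', heq⟩ := hP.edge 0 _ he'
    rcases Sym2.eq_iff.1 heq with ⟨-, rfl⟩ | ⟨rfl, rfl⟩
    · rw [hi] at hi'
      exact absurd hi' (by decide)
    · omega
  have hs2 : F₂ ⊆ F₂ ∪ F₃ := Finset.subset_union_left
  have hs3 : F₃ ⊆ F₂ ∪ F₃ := Finset.subset_union_right
  obtain ⟨p, hp⟩ : ∃ p : V → ℕ, ∀ v, p v = incCount (E 1 ∪ F₂) v := ⟨_, fun _ => rfl⟩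
  obtain ⟨q, hq⟩ : ∃ q : V → ℕ, ∀ v, q v = incCount (E 0 ∪ F₃) v := ⟨_, fun _ => rfl⟩
  have hp' : ∀ v, p v = incCount (E 1) v + incCount F₂ v := fun v => by
    rw [hp, incCount_union (hEF 1 F₂ hs2)]
  have hq' : ∀ v, q v = incCount (E 0) v + incCount F₃ v := fun v => by
    rw [hq, incCount_union (hEF 0 F₃ hs3)]
  have hFhigh : ∀ F ⊆ F₂ ∪ F₃, ∀ v, 3 ≤ c v → incCount F v = 0 := by
    intro F hFs v hv
    rw [incCount_eq_zero]
    intro e he hve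
    have := hFlow e (hFs he) v hve
    omega
  have hmono : ∀ v, c v ≤ 2 → p v = 0 ∨ q v = 0 ∨ (p v = 1 ∧ Even (q v)) := by
    intro v hv
    have := hval v (Set.mem_univ v)
    rwa [hx v hv, hy v hv, ← hp', ← hq'] at this
  -- vertices of high class
  have hhighEven : ∀ v, 3 ≤ c v → Even (c v) → p v = c v / 2 ∧ 1 ≤ q v ∧
      Odd (p v + q v) := by
    intro v hv hev
    have hvD := (hDiff v).2 hv
    have h0 : (c v : ZMod 2) = 0 := (ZMod.natCast_eq_zero_iff_even).2 hev
    have h1 := hP.exact v hvD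
    have h2 := hP.flexPos v hvD
    have h3 := hP.flexParity v hvD
    rw [h0] at h1 h2 h3
    rw [zero_add] at h1
    have e1 : p v = incCount (E 1) v := by rw [hp', hFhigh F₂ hs2 v hv, add_zero]
    have e2 : q v = incCount (E 0) v := by rw [hq', hFhigh F₃ hs3 v hv, add_zero]
    rw [← e1] at h1
    rw [← e2] at h2 h3
    refine ⟨h1, h2, ?_⟩
    rw [← ZMod.natCast_eq_one_iff_odd]
    push_cast
    rw [h3, h1]
    have : ∀ a : ZMod 2, a + (a + 0 + 1) = 1 := by decide
    exact this _
  have hhighOdd : ∀ v, 3 ≤ c v → Odd (c v) → q v = c v / 2 ∧ 1 ≤ p v ∧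
      Even (p v + q v) := by
    intro v hv hodd
    have hvD := (hDiff v).2 hv
    have h0 : (c v : ZMod 2) = 1 := (ZMod.natCast_eq_one_iff_odd).2 hodd
    have h1 := hP.exact v hvD
    have h2 := hP.flexPos v hvD
    have h3 := hP.flexParity v hvD
    have h11 : (1 : ZMod 2) + 1 = 0 := rfl
    rw [h0] at h1 h2 h3
    rw [h11] at h1
    have e1 : p v = incCount (E 1) v := by rw [hp', hFhigh F₂ hs2 v hv, add_zero]
    have e2 : q v = incCount (E 0) v := by rw [hq', hFhigh F₃ hs3 v hv, add_zero]
    rw [← e2] at h1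
    rw [← e1] at h2 h3
    refine ⟨h1, h2, ?_⟩
    rw [← ZMod.natCast_eq_zero_iff_even]
    push_cast
    rw [h3, h1]
    have : ∀ a : ZMod 2, a + 1 + 1 + a = 0 := by decide
    exact this _
  -- An even colour gives `p = c v / 2 ≥ 2`; an odd one gives `p + q` even, which excludes `p = 1`
  -- with `q` even.
  have hhigh : ∀ v, 3 ≤ c v → 1 ≤ p v ∧ 1 ≤ q v ∧ ¬ (p v = 1 ∧ Even (q v)) := by
    intro v hv
    rcases Nat.even_or_odd (c v) with hev | hodd
    · obtain ⟨h1, h2, -⟩ := hhighEven v hv hev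
      have : 2 ≤ c v / 2 := by
        rw [Nat.even_iff] at hev
        omega
      exact ⟨by omega, h2, fun h => by omega⟩
    · obtain ⟨h1, h2, h3⟩ := hhighOdd v hv hodd
      refine ⟨h2, by omega, fun h => ?_⟩
      rw [Nat.even_iff] at h3
      have := Nat.even_iff.1 h.2
      omega
  have hmixed : ∀ a b, c a ≤ 2 → 3 ≤ c b → p a ≠ p b ∨ q a ≠ q b := by
    intro a b ha hb
    have h1 := hmono a ha
    have h2 := hhigh b hb
    by_contra! hcon
    rw [hcon.1, hcon.2] at h1
    rcases h1 with h1 | h1 | h1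
    · omega
    · omega
    · exact h2.2.2 h1
  refine ⟨E 1 ∪ F₂, E 0 ∪ F₃, ?_, ?_, ?_⟩
  · rw [Finset.disjoint_union_left, Finset.disjoint_union_right, Finset.disjoint_union_right]
    exact ⟨⟨hE01, hEF 1 F₃ hs3⟩, (hEF 0 F₂ hs2).symm, hdisj⟩
  · have hEG : ∀ i, ∀ e ∈ E i, e ∈ G.edgeSet := by
      intro i e he
      obtain ⟨w, -, z, hwz, -, -, rfl⟩ := hP.edge i e he
      exact hwz
    have hFG : ∀ e ∈ F₂ ∪ F₃, e ∈ G.edgeSet := by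
      intro e he
      have := (hF e he).1
      induction e with
      | _ a b => exact this.1
    intro e he
    simp only [Finset.mem_union] at he hFG
    rcases he with (he | he) | (he | he)
    · exact hEG 1 e he
    · exact hFG e (Or.inl he)
    · exact hEG 0 e he
    · exact hFG e (Or.inr he)
  · intro a b hab
    rw [← hp, ← hp, ← hq, ← hq]
    by_cases ha : c a ≤ 2
    · by_cases hb : c b ≤ 2
      · have := hne a (Set.mem_univ a) b (Set.mem_univ b) ⟨hab, ha, hb⟩
        rwa [hx a ha, hx b hb, hy a ha, hy b hb, ← hp', ← hq', ← hp', ← hq'] at this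
      · exact hmixed a b ha (by omega)
    · by_cases hb : c b ≤ 2
      · exact (hmixed b a hb (by omega)).imp Ne.symm Ne.symm
      · have hne := hP.minSum.proper a b hab
        by_contra! hcon
        rcases Nat.even_or_odd (c a) with hae | hao <;>
          rcases Nat.even_or_odd (c b) with hbe | hbo
        · have h1 := (hhighEven a (by omega) hae).1
          have h2 := (hhighEven b (by omega) hbe).1
          rw [Nat.even_iff] at hae hbe
          omega
        · have h1 := (hhighEven a (by omega) hae).2.2
          have h2 := (hhighOdd b (by omega) hbo).2.2
          rw [hcon.1, hcon.2] at h1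
          exact Nat.not_even_iff_odd.2 h1 h2
        · have h1 := (hhighOdd a (by omega) hao).2.2
          have h2 := (hhighEven b (by omega) hbe).2.2
          rw [hcon.1, hcon.2] at h1
          exact Nat.not_even_iff_odd.2 h2 h1
        · have h1 := (hhighOdd a (by omega) hao).1
          have h2 := (hhighOdd b (by omega) hbo).1
          rw [Nat.odd_iff] at hao hbo
          omega

/-- The labelling with label `2` on `E₂`, label `3` on `E₃`, and label `1` elsewhere. -/
def labellingOfEdgeSets (G : SimpleGraph V) (E₂ E₃ : Finset (Sym2 V)) : G.NatLabelling 3 :=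
  fun e => ⟨if (e : Sym2 V) ∈ E₂ then 2 else if (e : Sym2 V) ∈ E₃ then 3 else 1, by
    split_ifs <;> simp⟩

lemma labelProd_labellingOfEdgeSets (G : SimpleGraph V) [DecidableRel G.Adj]
    {E₂ E₃ : Finset (Sym2 V)} (hdisj : Disjoint E₂ E₃) (hE : ∀ e ∈ E₂ ∪ E₃, e ∈ G.edgeSet)
    (v : V) : G.labelProd (G.labellingOfEdgeSets E₂ E₃) v =
      2 ^ incCount E₂ v * 3 ^ incCount E₃ v := by
  have hcard : ∀ E ⊆ E₂ ∪ E₃, #{u : G.neighborSet v | s(v, (u : V)) ∈ E} = incCount E v := by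
    intro E hsub
    unfold incCount
    refine Finset.card_bij (fun u _ => s(v, (u : V))) ?_ ?_ ?_
    · intro u hu
      simpa using hu
    · intro a _ b _ hab
      exact Subtype.ext (Sym2.congr_right.1 hab)
    · intro e he
      obtain ⟨heE, z, rfl⟩ := Finset.mem_filter.1 he
      exact ⟨⟨z, hE _ (hsub heE)⟩, by simpa using heE, rfl⟩
  have hval : ∀ u : G.neighborSet v,
      ((G.labellingOfEdgeSets E₂ E₃).get v u.1 u.2 : ℕ) =
        (if s(v, (u : V)) ∈ E₂ then 2 else 1) * (if s(v, (u : V)) ∈ E₃ then 3 else 1) := by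
    intro u
    change (if s(v, (u : V)) ∈ E₂ then 2 else if s(v, (u : V)) ∈ E₃ then 3 else 1) = _
    by_cases h2 : s(v, (u : V)) ∈ E₂
    · have h3 : s(v, (u : V)) ∉ E₃ := Finset.disjoint_left.1 hdisj h2
      simp [h2, h3]
    · simp [h2]
  unfold labelProd
  rw [Finset.prod_congr rfl fun u _ => hval u, Finset.prod_mul_distrib, ← Finset.prod_filter,
    ← Finset.prod_filter, Finset.prod_const, Finset.prod_const,
    hcard E₂ Finset.subset_union_left, hcard E₃ Finset.subset_union_right]

/-- Every nice finite graph has a p-proper `3`-labelling; regularity is not needed. -/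
theorem IsNice.exists_isPProper {G : SimpleGraph V} [DecidableRel G.Adj] (h : G.IsNice) :
    ∃ l : G.NatLabelling 3, G.IsPProper l := by
  obtain ⟨E₂, E₃, hdisj, hE, hne⟩ := h.exists_edge_sets
  refine ⟨G.labellingOfEdgeSets E₂ E₃, fun a b hab heq => ?_⟩
  rw [labelProd_labellingOfEdgeSets G hdisj hE, labelProd_labellingOfEdgeSets G hdisj hE] at heq
  have hfac : ∀ m n : ℕ, (2 ^ m * 3 ^ n).factorization 2 = m ∧
      (2 ^ m * 3 ^ n).factorization 3 = n := by
    intro m n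
    rw [Nat.factorization_mul (by positivity) (by positivity), Nat.Prime.factorization_pow
      Nat.prime_two, Nat.Prime.factorization_pow Nat.prime_three]
    simp
  have h2 : incCount E₂ a = incCount E₂ b := by
    rw [← (hfac (incCount E₂ a) (incCount E₃ a)).1, heq, (hfac _ _).1]
  have h3 : incCount E₃ a = incCount E₃ b := by
    rw [← (hfac (incCount E₂ a) (incCount E₃ a)).2, heq, (hfac _ _).2]
  exact (hne a b hab).elim (fun h => h h2) (fun h => h h3)

end Labelling

end SimpleGraph

theorem mainTheorem4 {V : Type*} [Fintype V] (G : SimpleGraph V) [DecidableRel G.Adj]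
    (hnice : G.IsNice) (Δ : ℕ) (hreg : G.IsRegularOfDegree Δ) :
    G.chiP ≤ 3 := by
  classical
  exact iInf₂_le 3 ⟨by norm_num, hnice.exists_isPProper⟩
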